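/- Let $N\ge 1$ and let $\beta\ge 0$ be an integer. Let $s_{jk}$ act on $\mathbb C[x]=\mathbb C[x_1,\dots,x_N]$ by exchanging $x_j$ and $x_k$, and put $$D_j=\frac{\partial}{\partial x_j}+\beta\sum_{k\ne j}\frac{1-s_{jk}}{x_j-x_k},\quad \tilde a_j^\dagger=\tfrac1{\sqrt2}(-D_j+2x_j),\quad \tilde a_j=\tfrac1{\sqrt2}D_j,\quad \tilde h_j=\tilde a_j^\dagger\tilde a_j+\beta\sum_{k<j}s_{jk}.$$ The operators $\tilde h_1,\dots,\tilde h_N$ commute. Put $\mathcal X=\prod_{i<j}(x_i-x_j)$, $$\mathcal Y_H=\prod_{i<j}(\beta+\tilde h_i-\tilde h_j),\quad \hat{\mathcal Y}_H=\prod_{i<j}(-\beta+\tilde h_i-\tilde h_j),\quad G_H=\mathcal X^{-1}\mathcal Y_H,\quad \hat G_H=\hat{\mathcal Y}_H\mathcal X .$$ For partitions $\lambda=(\lambda_1\ge\dots\ge\lambda_N\ge 0)$ and $\mu$ write $\mu<\lambda$ if $\mu\neq\lambda$ and $\mu_1+\dots+\mu_k\le\lambda_1+\dots+\lambda_k$ for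 $k=1,\dots,N$ (equal weights are not required), and let $m_\lambda$ be the monomial symmetric polynomial. The multivariable Hermite polynomial $H^{(\beta)}_\lambda$ is the unique polynomial such that (i) $H^{(\beta)}_\lambda=m_\lambda+\sum_{\mu<\lambda}u_{\lambda\mu}m_\mu$ for some $u_{\lambda\mu}\in\mathbb C$; (ii) $\langle H^{(\beta)}_\lambda,m_\mu\rangle^{(\beta)}=0$ for all $\mu<\lambda$, where $\langle f,g\rangle^{(\beta)}=\int_{\mathbb R^N}f(x)g(x)\prod_{j<k}|x_j-x_k|^{2\beta}\prod_j e^{-x_j^2}\,dx$. Let $\delta=(N-1,N-2,\dots,0)$. Then for every partition $\lambda$ with at most $N$ parts the polynomials $H^{(\beta)}_{\lambda+\delta}$ and $H^{(\beta+1)}_\lambda$ exist and are unique, and $$G_H H^{(\beta)}_{\lambda+\delta}=c^{(\beta+1)}_\lambda H^{(\beta+1)}_\lambda,\qquad \hat G_H H^{(\beta+1)}_\lambda=\tilde c^{(\beta+1)}_\lambda H^{(\beta)}_{\lambda+\delta},$$ where $$c^{(\beta+1)}_\lambda=\prod_{i<j}\{\lambda_{N-j+1}-\lambda_{N-i+1}+j-i+\beta(j-i-1)\},\qquad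 \tilde c^{(\beta+1)}_\lambda=\prod_{i<j}\{\lambda_{N-j+1}-\lambda_{N-i+1}+j-i+\beta(j-i+1)\}.$$ -/

import Mathlib

open MvPolynomial MeasureTheory

noncomputable section

namespace HermiteShift

/-- The polynomial ring `ℂ[x₁, …, x_N]`; the variables are indexed by `Fin N`, starting at `0`. -/
abbrev Poly (N : ℕ) : Type := MvPolynomial (Fin N) ℂ

/-- The exchange operator `s_{jk}` on polynomials, permuting the arguments `x_j` and `x_k`. -/
def exch {N : ℕ} (j k : Fin N) : Poly N →ₗ[ℂ] Poly N :=
  (rename (Equiv.swap j k) : Poly N →ₐ[ℂ] Poly N).toLinearMap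

theorem X_sub_X_dvd {N : ℕ} (j k : Fin N) (f : Poly N) :
    (X j - X k : Poly N) ∣ f - exch j k f := by
  have key : ∀ n : Fin N, (X j - X k : Poly N) ∣ X n - X (Equiv.swap j k n) := by
    intro n
    rcases eq_or_ne n j with rfl | hj
    · simp
    · rcases eq_or_ne n k with rfl | hk
      · rw [Equiv.swap_apply_right]
        exact ⟨-1, by ring⟩
      · rw [Equiv.swap_apply_of_ne_of_ne hj hk]
        simp
  induction f using MvPolynomial.induction_on with
  | C a => simp [exch]
  | add p q hp hq =>
    have := dvd_add hp hq
    rw [map_add]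
    convert this using 1
    ring
  | mul_X p n hp =>
    have h : p * X n - exch j k (p * X n)
        = (p - exch j k p) * X n + exch j k p * (X n - X (Equiv.swap j k n)) := by
      simp only [exch, AlgHom.toLinearMap_apply, map_mul, rename_X]
      ring
    rw [h]
    exact dvd_add (Dvd.dvd.mul_right hp _) (Dvd.dvd.mul_left (key n) _)

theorem X_sub_X_ne_zero {N : ℕ} {j k : Fin N} (h : j ≠ k) : (X j - X k : Poly N) ≠ 0 :=
  sub_ne_zero.mpr fun e => h (X_injective e)

/-- The operator `(1 - s_{jk}) / (x_j - x_k)` on polynomials, for `j ≠ k`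
(it is given the value `0` for `j = k`, which is never used). -/
def divDiff {N : ℕ} (j k : Fin N) : Poly N →ₗ[ℂ] Poly N :=
  if h : j = k then 0 else
  { toFun := fun f => (X_sub_X_dvd j k f).choose
    map_add' := fun f g => mul_left_cancel₀ (X_sub_X_ne_zero h) (by
      rw [mul_add, ← (X_sub_X_dvd j k f).choose_spec, ← (X_sub_X_dvd j k g).choose_spec,
        ← (X_sub_X_dvd j k (f + g)).choose_spec, map_add]
      ring)
    map_smul' := fun c f => mul_left_cancel₀ (X_sub_X_ne_zero h) (by
      rw [RingHom.id_apply, mul_smul_comm, ← (X_sub_X_dvd j k f).choose_spec,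
        ← (X_sub_X_dvd j k (c • f)).choose_spec, map_smul, smul_sub]) }

/-- The defining property of `divDiff`. -/
theorem divDiff_spec {N : ℕ} {j k : Fin N} (h : j ≠ k) (f : Poly N) :
    (X j - X k) * divDiff j k f = f - exch j k f := by
  simp only [divDiff, dif_neg h]
  exact (X_sub_X_dvd j k f).choose_spec.symm

/-- The type `A` Dunkl operator `D_j = ∂/∂x_j + β ∑_{k ≠ j} (1 - s_{jk}) / (x_j - x_k)`. -/
def dunkl (N β : ℕ) (j : Fin N) : Poly N →ₗ[ℂ] Poly N :=
  (pderiv j : Derivation ℂ (Poly N) (Poly N)).toLinearMap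
    + (β : ℂ) • ∑ k ∈ Finset.univ.filter (fun k => k ≠ j), divDiff j k

/-- The gauge-transformed creation operator `(1/√2) (-D_j + 2 x_j)`. -/
def creation (N β : ℕ) (j : Fin N) : Poly N →ₗ[ℂ] Poly N :=
  (1 / (Real.sqrt 2 : ℂ)) • (-dunkl N β j + (2 : ℂ) • LinearMap.mulLeft ℂ (X j : Poly N))

/-- The gauge-transformed annihilation operator `(1/√2) D_j`. -/
def annihilation (N β : ℕ) (j : Fin N) : Poly N →ₗ[ℂ] Poly N :=
  (1 / (Real.sqrt 2 : ℂ)) • dunkl N β j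

/-- The Cherednik-type operator `h_j = a†_j a_j + β ∑_{k < j} s_{jk}`. -/
def hOp (N β : ℕ) (j : Fin N) : Poly N →ₗ[ℂ] Poly N :=
  creation N β j ∘ₗ annihilation N β j
    + (β : ℂ) • ∑ k ∈ Finset.univ.filter (fun k => k < j), exch j k

/-- The product (composition) over the pairs `i < j` of the operators `F i j`, in lexicographic
order of the pairs. It is only used for commuting factors, for which the order is immaterial. -/
def pairProd {N : ℕ} (F : Fin N → Fin N → Module.End ℂ (Poly N)) : Module.End ℂ (Poly N) :=
  ((List.finRange N).flatMap fun i =>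
    ((List.finRange N).filter fun j => i < j).map fun j => F i j).prod

/-- `𝒴 = ∏_{i<j} (β + h_i - h_j)`. -/
def opY (N β : ℕ) : Module.End ℂ (Poly N) :=
  pairProd fun i j => (β : ℂ) • (1 : Module.End ℂ (Poly N)) + hOp N β i - hOp N β j

/-- `𝒴̂ = ∏_{i<j} (-β + h_i - h_j)`. -/
def opYhat (N β : ℕ) : Module.End ℂ (Poly N) :=
  pairProd fun i j => -((β : ℂ) • (1 : Module.End ℂ (Poly N))) + hOp N β i - hOp N β j

/-- `𝒳 = ∏_{i<j} (x_i - x_j)`. -/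
def vand (N : ℕ) : Poly N :=
  ∏ i : Fin N, ∏ j ∈ Finset.univ.filter (fun j => i < j), (X i - X j)

/-- The shift operator `G_H = 𝒳⁻¹ 𝒴`, with values in the field of rational functions. -/
def shiftG (N β : ℕ) (f : Poly N) : FractionRing (Poly N) :=
  (algebraMap (Poly N) (FractionRing (Poly N)) (vand N))⁻¹
    * algebraMap (Poly N) (FractionRing (Poly N)) (opY N β f)

/-- The shift operator `Ĝ_H = 𝒴̂ 𝒳`. -/
def shiftGhat (N β : ℕ) (f : Poly N) : Poly N :=
  opYhat N β (vand N * f)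

/-- The monomial symmetric polynomial `m_l`: the sum of the distinct monomials obtained from
`x^l` by permuting the exponents. -/
def msym {N : ℕ} (l : Fin N → ℕ) : Poly N :=
  ∑ a ∈ Finset.univ.image (fun w : Equiv.Perm (Fin N) => l ∘ w),
    monomial (Finsupp.equivFunOnFinite.symm a) (1 : ℂ)

/-- The dominance order on partitions, not necessarily of the same weight:
`μ₁ + ⋯ + μ_k ≤ l₁ + ⋯ + l_k` for `k = 1, …, N`, and `μ ≠ l`. -/
def DomLT {N : ℕ} (μ l : Fin N → ℕ) : Prop :=
  (∀ k : Fin N, ∑ i ∈ Finset.Iic k, μ i ≤ ∑ i ∈ Finset.Iic k, l i) ∧ μ ≠ l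

/-- The ground state `∏_{j<k} |x_j - x_k|^β ∏_j exp (-x_j² / 2)`. -/
def groundState (N β : ℕ) (x : Fin N → ℝ) : ℝ :=
  (∏ j : Fin N, ∏ k ∈ Finset.univ.filter (fun k => j < k), |x j - x k| ^ β)
    * ∏ j : Fin N, Real.exp (-(x j) ^ 2 / 2)

/-- The scalar product `⟨f, g⟩ = ∫ f g φ² dx₁ ⋯ dx_N`, with `φ` the ground state. -/
def scal (N β : ℕ) (f g : Poly N) : ℂ :=
  ∫ x : Fin N → ℝ, eval (fun i => (x i : ℂ)) f * eval (fun i => (x i : ℂ)) g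
    * ((groundState N β x : ℝ) : ℂ) ^ 2

/-- `P` is the multivariable Hermite polynomial `H_l^{(β)}`: it is `m_l` plus a linear combination
of the `m_μ` with `μ` a partition below `l`, and it is orthogonal to these `m_μ`. -/
def IsHermite (N β : ℕ) (l : Fin N → ℕ) (P : Poly N) : Prop :=
  P - msym l ∈ Submodule.span ℂ {p | ∃ μ : Fin N → ℕ, Antitone μ ∧ DomLT μ l ∧ p = msym μ} ∧
  ∀ μ : Fin N → ℕ, Antitone μ → DomLT μ l → scal N β P (msym μ) = 0

/-- The staircase `δ = (N-1, N-2, …, 0)`. -/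
def stair (N : ℕ) (i : Fin N) : ℕ := (Fin.rev i : ℕ)

/-- `c_l^{(β+1)} = ∏_{i<j} (l_{N-j+1} - l_{N-i+1} + j - i + β (j - i - 1))`. -/
def shiftC (N β : ℕ) (l : Fin N → ℕ) : ℂ :=
  ∏ i : Fin N, ∏ j ∈ Finset.univ.filter (fun j => i < j),
    ((l (Fin.rev j) : ℂ) - (l (Fin.rev i) : ℂ) + (j : ℕ) - (i : ℕ)
      + (β : ℂ) * ((j : ℕ) - (i : ℕ) - 1))

/-- `c̃_l^{(β+1)} = ∏_{i<j} (l_{N-j+1} - l_{N-i+1} + j - i + β (j - i + 1))`. -/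
def shiftCtilde (N β : ℕ) (l : Fin N → ℕ) : ℂ :=
  ∏ i : Fin N, ∏ j ∈ Finset.univ.filter (fun j => i < j),
    ((l (Fin.rev j) : ℂ) - (l (Fin.rev i) : ℂ) + (j : ℕ) - (i : ℕ)
      + (β : ℂ) * ((j : ℕ) - (i : ℕ) + 1))

end HermiteShift

end

noncomputable section

namespace HermiteShift

variable {N β : ℕ}

/-! The operators `h_i` commute, are self-adjoint for the scalar product, and are triangular for the
dominance order. With adjacent exchanges they satisfy the degenerate affine Hecke relation
(`exch_hHom`). That relation shows that `𝒴` sends symmetric polynomials to skew-symmetric ones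
(`isAlt_opY`) and that `𝒴̂` sends skew-symmetric ones to symmetric ones (`isSym_opYhat`). A
skew-symmetric polynomial is the Vandermonde product times a symmetric one (`exists_vand_mul`), so
both shift operators send symmetric polynomials to symmetric polynomials.

It remains to recognise the images as Hermite polynomials. Such a polynomial is characterised, up to
its leading coefficient, by its leading term and by orthogonality to everything lower
(`IsHermite.eq_smul`). Multiplying both arguments by the Vandermonde product turns the pairing at `β
+ 1` into the pairing at `β` (`scal_vand_mul`). Self-adjointness (`scal_hHom`) then moves `𝒴` or
`𝒴̂` onto the test polynomial, where triangularity keeps it below the required partition. The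
constants are the values of the two products at the diagonal entries of the `h_i`
(`coeff_revExpo_hHom`), up to the sign of the leading coefficient of the Vandermonde product.

Triangularity is proved without expanding divided differences of monomials: `lowPoly` is cut out by
degree bounds in all subsets of the variables. Such degrees add under multiplication, so the bounds
survive division by `x_i - x_k`. Self-adjointness comes from Gaussian integration by parts. As `β`
is a natural number, the weight is a polynomial times a Gaussian. Existence and uniqueness of the
Hermite polynomials follow from positivity on a finite-dimensional span. -/

/-! ### Exchanges, divided differences and commuting Dunkl operators -/

theorem exch_apply (j k : Fin N) (f : Poly N) : exch j k f = rename (Equiv.swap j k) f := rfl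

theorem exch_comm (j k : Fin N) : (exch j k : Poly N →ₗ[ℂ] Poly N) = exch k j := by
  unfold exch; rw [Equiv.swap_comm]

theorem rename_exch (w : Equiv.Perm (Fin N)) (j k : Fin N) (f : Poly N) :
    rename w (exch j k f) = exch (w j) (w k) (rename w f) := by
  rw [exch_apply, exch_apply, rename_rename, rename_rename]
  congr 1
  ext x
  simp [Equiv.swap_apply_apply]

theorem divDiff_eq_of_mul_eq {j k : Fin N} (h : j ≠ k) {f g : Poly N}
    (hg : (X j - X k) * g = f - exch j k f) : divDiff j k f = g :=
  mul_left_cancel₀ (X_sub_X_ne_zero h) ((divDiff_spec h f).trans hg.symm)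

theorem rename_divDiff (w : Equiv.Perm (Fin N)) {j k : Fin N} (h : j ≠ k) (f : Poly N) :
    rename w (divDiff j k f) = divDiff (w j) (w k) (rename w f) := by
  refine (divDiff_eq_of_mul_eq (w.injective.ne h) ?_).symm
  rw [← rename_exch, ← map_sub, ← divDiff_spec h f, map_mul, map_sub, rename_X, rename_X]

theorem exch_X_mul_of_ne {j k l : Fin N} (hj : l ≠ j) (hk : l ≠ k) (f : Poly N) :
    exch j k (X l * f) = X l * exch j k f := by
  rw [exch_apply, map_mul, rename_X, Equiv.swap_apply_of_ne_of_ne hj hk, exch_apply]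

theorem exch_X_mul_left (j k : Fin N) (f : Poly N) :
    exch j k (X j * f) = X k * exch j k f := by
  rw [exch_apply, map_mul, rename_X, Equiv.swap_apply_left, exch_apply]

theorem exch_X_mul_right (j k : Fin N) (f : Poly N) :
    exch j k (X k * f) = X j * exch j k f := by
  rw [exch_apply, map_mul, rename_X, Equiv.swap_apply_right, exch_apply]

theorem exch_exch (j k : Fin N) (f : Poly N) : exch j k (exch j k f) = f := by
  rw [exch_apply, exch_apply, rename_rename]
  convert rename_id_apply f
  ext x
  simp

theorem divDiff_X_mul_of_ne {j k l : Fin N} (h : j ≠ k) (hj : l ≠ j) (hk : l ≠ k) (f : Poly N) :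
    divDiff j k (X l * f) = X l * divDiff j k f := by
  refine divDiff_eq_of_mul_eq h ?_
  rw [exch_X_mul_of_ne hj hk]
  linear_combination X l * divDiff_spec h f

theorem divDiff_X_mul_left {j k : Fin N} (h : j ≠ k) (f : Poly N) :
    divDiff j k (X j * f) = X j * divDiff j k f + exch j k f := by
  refine divDiff_eq_of_mul_eq h ?_
  rw [exch_X_mul_left]
  linear_combination X j * divDiff_spec h f

theorem divDiff_X_mul_right {j k : Fin N} (h : j ≠ k) (f : Poly N) :
    divDiff j k (X k * f) = X k * divDiff j k f - exch j k f := by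
  refine divDiff_eq_of_mul_eq h ?_
  rw [exch_X_mul_right]
  linear_combination X k * divDiff_spec h f

theorem dunkl_apply (j : Fin N) (f : Poly N) :
    dunkl N β j f = pderiv j f
      + (β : ℂ) • ∑ k ∈ Finset.univ.filter (fun k => k ≠ j), divDiff j k f := by
  simp [dunkl]

theorem rename_dunkl (w : Equiv.Perm (Fin N)) (j : Fin N) (f : Poly N) :
    rename w (dunkl N β j f) = dunkl N β (w j) (rename w f) := by
  rw [dunkl_apply, dunkl_apply, map_add, map_smul, map_sum, pderiv_rename w.injective]
  congr 2
  refine Finset.sum_equiv w (by simp) fun k hk => ?_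
  exact rename_divDiff w (Finset.mem_filter.1 hk).2.symm f

theorem dunkl_X_mul_of_ne {i j : Fin N} (h : i ≠ j) (f : Poly N) :
    dunkl N β i (X j * f) = X j * dunkl N β i f - (β : ℂ) • exch i j f := by
  have hs : ∑ k ∈ Finset.univ.filter (fun k => k ≠ i), divDiff i k (X j * f)
      = X j * ∑ k ∈ Finset.univ.filter (fun k => k ≠ i), divDiff i k f - exch i j f := by
    have hj : j ∈ Finset.univ.filter (fun k => k ≠ i) := by simp [h.symm]
    rw [← Finset.add_sum_erase _ _ hj, ← Finset.add_sum_erase _ (fun k => divDiff i k f) hj,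
      divDiff_X_mul_right h, mul_add, Finset.mul_sum]
    rw [Finset.sum_congr rfl fun k hk => ?_]
    · ring
    · simp only [Finset.mem_erase, Finset.mem_filter] at hk
      exact divDiff_X_mul_of_ne hk.2.2.symm h.symm hk.1.symm f
  rw [dunkl_apply, dunkl_apply, hs, pderiv_mul, pderiv_X_of_ne h.symm]
  simp only [smul_eq_C_mul]
  ring

theorem dunkl_X_mul_self (i : Fin N) (f : Poly N) :
    dunkl N β i (X i * f) = X i * dunkl N β i f + f
      + (β : ℂ) • ∑ k ∈ Finset.univ.filter (fun k => k ≠ i), exch i k f := by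
  have hs : ∑ k ∈ Finset.univ.filter (fun k => k ≠ i), divDiff i k (X i * f)
      = X i * ∑ k ∈ Finset.univ.filter (fun k => k ≠ i), divDiff i k f
        + ∑ k ∈ Finset.univ.filter (fun k => k ≠ i), exch i k f := by
    rw [Finset.mul_sum, ← Finset.sum_add_distrib]
    exact Finset.sum_congr rfl fun k hk =>
      divDiff_X_mul_left (Finset.mem_filter.1 hk).2.symm f
  rw [dunkl_apply, dunkl_apply, hs, pderiv_mul, pderiv_X_self]
  simp only [smul_eq_C_mul]
  ring

theorem dunkl_C (i : Fin N) (a : ℂ) : dunkl N β i (C a) = 0 := by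
  rw [dunkl_apply, pderiv_C, Finset.sum_eq_zero, smul_zero, add_zero]
  intro k hk
  refine divDiff_eq_of_mul_eq (Finset.mem_filter.1 hk).2.symm ?_
  simp [exch_apply]

theorem exch_dunkl_of_ne {i j k : Fin N} (hj : i ≠ j) (hk : i ≠ k) (f : Poly N) :
    exch j k (dunkl N β i f) = dunkl N β i (exch j k f) := by
  rw [exch_apply, rename_dunkl, Equiv.swap_apply_of_ne_of_ne hj hk, exch_apply]

theorem exch_dunkl_left (j k : Fin N) (f : Poly N) :
    exch j k (dunkl N β j f) = dunkl N β k (exch j k f) := by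
  rw [exch_apply, rename_dunkl, Equiv.swap_apply_left, exch_apply]

theorem exch_dunkl_right (j k : Fin N) (f : Poly N) :
    exch j k (dunkl N β k f) = dunkl N β j (exch j k f) := by
  rw [exch_apply, rename_dunkl, Equiv.swap_apply_right, exch_apply]

/-- Inductive step for commutativity in the one delicate case, where the new variable belongs to one
of the two operators. The exchange terms produced by the two product rules cancel. -/
theorem dunkl_comm_X_mul {i j : Fin N} (h : i ≠ j) {p : Poly N}
    (hp : dunkl N β i (dunkl N β j p) = dunkl N β j (dunkl N β i p)) :
    dunkl N β i (dunkl N β j (X j * p)) = dunkl N β j (dunkl N β i (X j * p)) := by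
  -- `D_i` passes through every `s_{jk}` except `s_{ji}`, which turns it into `D_j`; that term is
  -- split off.
  have hs : ∑ k ∈ Finset.univ.filter (fun k => k ≠ j), dunkl N β i (exch j k p)
      = ∑ k ∈ Finset.univ.filter (fun k => k ≠ j), exch j k (dunkl N β i p)
        + dunkl N β i (exch i j p) - dunkl N β j (exch i j p) := by
    have hi : i ∈ Finset.univ.filter (fun k => k ≠ j) := by simp [h]
    rw [← Finset.add_sum_erase _ _ hi,
      ← Finset.add_sum_erase _ (fun k => exch j k (dunkl N β i p)) hi, exch_dunkl_right,
      exch_comm j i, Finset.sum_congr rfl fun k hk => ?_]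
    · ring
    · simp only [Finset.mem_erase, Finset.mem_filter] at hk
      exact (exch_dunkl_of_ne h hk.1.symm p).symm
  rw [dunkl_X_mul_self, dunkl_X_mul_of_ne h]
  simp only [map_add, map_sub, map_smul, map_sum]
  rw [dunkl_X_mul_self, dunkl_X_mul_of_ne h, hs, hp, exch_dunkl_right]
  simp only [smul_eq_C_mul]
  ring

theorem dunkl_comm (i j : Fin N) (f : Poly N) :
    dunkl N β i (dunkl N β j f) = dunkl N β j (dunkl N β i f) := by
  rcases eq_or_ne i j with rfl | h
  · rfl
  induction f using MvPolynomial.induction_on with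
  | C a => simp [dunkl_C]
  | add p q hp hq => simp only [map_add, hp, hq]
  | mul_X p n hp =>
    rw [mul_comm p]
    rcases eq_or_ne n j with rfl | hj
    · exact dunkl_comm_X_mul h hp
    rcases eq_or_ne n i with rfl | hi
    · exact (dunkl_comm_X_mul h.symm hp.symm).symm
    · rw [dunkl_X_mul_of_ne hj.symm, dunkl_X_mul_of_ne hi.symm]
      simp only [map_sub, map_smul]
      rw [dunkl_X_mul_of_ne hj.symm, dunkl_X_mul_of_ne hi.symm, hp,
        exch_dunkl_of_ne h.symm hj.symm, exch_dunkl_of_ne h hi.symm]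
      simp only [smul_eq_C_mul]
      ring

/-! ### Commutativity of the Cherednik-type operators -/

/-- The number-type operator `a†_i a_i`. -/
def numOp (N β : ℕ) (i : Fin N) : Poly N →ₗ[ℂ] Poly N :=
  creation N β i ∘ₗ annihilation N β i

theorem numOp_apply (i : Fin N) (f : Poly N) :
    numOp N β i f = X i * dunkl N β i f - (1 / 2 : ℂ) • dunkl N β i (dunkl N β i f) := by
  have h2 : (1 / (Real.sqrt 2 : ℂ)) * (1 / (Real.sqrt 2 : ℂ)) = 1 / 2 := by
    rw [div_mul_div_comm, ← Complex.ofReal_mul, Real.mul_self_sqrt zero_le_two]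
    norm_num
  simp only [numOp, creation, annihilation, LinearMap.comp_apply, LinearMap.smul_apply, map_smul,
    smul_smul, h2, LinearMap.add_apply, LinearMap.neg_apply, LinearMap.mulLeft_apply]
  rw [smul_add, smul_smul]
  norm_num
  ring

/-- The Jucys–Murphy-type sum `∑_{k < i} s_{ik}`. -/
def jmOp (N : ℕ) (i : Fin N) : Poly N →ₗ[ℂ] Poly N :=
  ∑ k ∈ Finset.univ.filter (fun k => k < i), exch i k

theorem hOp_apply (i : Fin N) (f : Poly N) :
    hOp N β i f = numOp N β i f + (β : ℂ) • jmOp N i f := rfl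

theorem jmOp_apply (i : Fin N) (f : Poly N) :
    jmOp N i f = ∑ k ∈ Finset.univ.filter (fun k => k < i), exch i k f := by
  simp [jmOp]

theorem rename_numOp (w : Equiv.Perm (Fin N)) (i : Fin N) (f : Poly N) :
    rename w (numOp N β i f) = numOp N β (w i) (rename w f) := by
  simp only [numOp_apply, map_sub, map_mul, map_smul, rename_dunkl, rename_X]

theorem exch_numOp_of_ne {i j k : Fin N} (hj : i ≠ j) (hk : i ≠ k) (f : Poly N) :
    exch j k (numOp N β i f) = numOp N β i (exch j k f) := by
  rw [exch_apply, rename_numOp, Equiv.swap_apply_of_ne_of_ne hj hk, exch_apply]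

theorem exch_numOp_left (j k : Fin N) (f : Poly N) :
    exch j k (numOp N β j f) = numOp N β k (exch j k f) := by
  rw [exch_apply, rename_numOp, Equiv.swap_apply_left, exch_apply]

/-- The Dunkl operators commute, so the only obstruction is `[D_i, x_j] = -β s_{ij}`. The remainder
is what the exchange sums in `h_i` and `h_j` compensate. -/
theorem numOp_numOp_sub {i j : Fin N} (h : i ≠ j) (f : Poly N) :
    numOp N β i (numOp N β j f) - numOp N β j (numOp N β i f)
      = (β : ℂ) • (numOp N β j (exch i j f) - numOp N β i (exch i j f)) := by
  simp only [numOp_apply, map_sub, map_smul, dunkl_X_mul_of_ne h, dunkl_X_mul_of_ne h.symm,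
    exch_dunkl_left, exch_dunkl_right, exch_comm j i]
  rw [dunkl_comm j i f, dunkl_comm i j (dunkl N β j f), dunkl_comm j i (dunkl N β i f),
    ← dunkl_comm i j f, dunkl_comm i j (dunkl N β i (dunkl N β j f)),
    ← dunkl_comm i j (dunkl N β j f), dunkl_comm i j (exch i j f)]
  simp only [dunkl_comm j i]
  simp only [smul_eq_C_mul]
  ring

theorem exch_jmOp {i k j : Fin N} (hi : i < j) (hk : k < j) (f : Poly N) :
    exch i k (jmOp N j f) = jmOp N j (exch i k f) := by
  rw [jmOp_apply, jmOp_apply, map_sum]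
  refine Finset.sum_equiv (Equiv.swap i k) (fun l => ?_) fun l _ => ?_
  · simp only [Finset.mem_filter, Finset.mem_univ, true_and]
    rcases eq_or_ne l i with rfl | h1
    · simp [hi, hk]
    rcases eq_or_ne l k with rfl | h2
    · simp [hi, hk]
    rw [Equiv.swap_apply_of_ne_of_ne h1 h2]
  · rw [exch_apply i k, rename_exch, Equiv.swap_apply_of_ne_of_ne hi.ne' hk.ne', exch_apply i k]

theorem jmOp_comm_of_lt {i j : Fin N} (h : i < j) (f : Poly N) :
    jmOp N i (jmOp N j f) = jmOp N j (jmOp N i f) := by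
  rw [jmOp_apply i, jmOp_apply i, map_sum]
  exact Finset.sum_congr rfl fun k hk => exch_jmOp h ((Finset.mem_filter.1 hk).2.trans h) f

theorem jmOp_numOp_of_lt {i j : Fin N} (h : i < j) (f : Poly N) :
    jmOp N i (numOp N β j f) = numOp N β j (jmOp N i f) := by
  rw [jmOp_apply i, jmOp_apply i, map_sum]
  exact Finset.sum_congr rfl fun k hk =>
    exch_numOp_of_ne h.ne' ((Finset.mem_filter.1 hk).2.trans h).ne' f

/-- Only the summand `s_{ij}` of the exchange sum fails to commute with `a†_i a_i`. Multiplied by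
`β`, the resulting commutator is opposite to that of `numOp_numOp_sub`. -/
theorem numOp_jmOp_of_lt {i j : Fin N} (h : i < j) (f : Poly N) :
    numOp N β i (jmOp N j f) = jmOp N j (numOp N β i f)
      + numOp N β i (exch i j f) - numOp N β j (exch i j f) := by
  have hi : i ∈ Finset.univ.filter (fun k => k < j) := by simp [h]
  rw [jmOp_apply, jmOp_apply, map_sum, ← Finset.add_sum_erase _ _ hi,
      ← Finset.add_sum_erase _ (fun k => exch j k (numOp N β i f)) hi,
      exch_comm j i, exch_numOp_left, Finset.sum_congr rfl fun k hk => ?_]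
  · ring
  · exact (exch_numOp_of_ne h.ne (Finset.mem_erase.1 hk).1.symm f).symm

theorem hOp_comm_of_lt {i j : Fin N} (h : i < j) (f : Poly N) :
    hOp N β i (hOp N β j f) = hOp N β j (hOp N β i f) := by
  simp only [hOp_apply, map_add, map_smul]
  rw [numOp_jmOp_of_lt h, jmOp_numOp_of_lt h, jmOp_comm_of_lt h]
  have := numOp_numOp_sub (β := β) h.ne f
  simp only [smul_eq_C_mul] at this ⊢
  linear_combination this

theorem hOp_comm (i j : Fin N) : hOp N β i * hOp N β j = hOp N β j * hOp N β i := by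
  rcases lt_trichotomy i j with h | rfl | h
  · refine LinearMap.ext fun f => ?_
    rw [Module.End.mul_apply, Module.End.mul_apply, hOp_comm_of_lt h]
  · rfl
  · refine LinearMap.ext fun f => ?_
    rw [Module.End.mul_apply, Module.End.mul_apply, hOp_comm_of_lt h]

/-! ### Polynomials in the operators `h_i` and the Hecke relation -/

/-- `aeval` needs a commutative target, so the substitution goes through the subalgebra generated by
the `h_i`, which is commutative by `hOp_comm`. -/
theorem exists_hOp_algHom (N β : ℕ) :
    ∃ φ : MvPolynomial (Fin N) ℂ →ₐ[ℂ] Module.End ℂ (Poly N), ∀ i, φ (X i) = hOp N β i := by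
  have hc := Algebra.isMulCommutative_adjoin ℂ
    (s := Set.range (hOp N β : Fin N → Module.End ℂ (Poly N)))
    (by rintro _ ⟨i, rfl⟩ _ ⟨j, rfl⟩; exact hOp_comm i j)
  let _ : CommRing (Algebra.adjoin ℂ (Set.range (hOp N β : Fin N → Module.End ℂ (Poly N)))) :=
    { (inferInstance : Ring _) with mul_comm := hc.1.1 }
  refine ⟨(Algebra.adjoin ℂ (Set.range (hOp N β : Fin N → Module.End ℂ (Poly N)))).val.comp
    (aeval fun i => ⟨hOp N β i, Algebra.subset_adjoin ⟨i, rfl⟩⟩), fun i => ?_⟩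
  simp

/-- The substitution of the commuting operators `h_i` for the variables of a polynomial. -/
def hHom (N β : ℕ) : MvPolynomial (Fin N) ℂ →ₐ[ℂ] Module.End ℂ (Poly N) :=
  (exists_hOp_algHom N β).choose

theorem hHom_X (i : Fin N) : hHom N β (X i) = hOp N β i := (exists_hOp_algHom N β).choose_spec i

/-- The polynomial `∏_{i<j} (c + X_i - X_j)`. -/
def pairPoly (N : ℕ) (c : ℂ) : Poly N :=
  ∏ i : Fin N, ∏ j ∈ Finset.univ.filter (fun j => i < j), (C c + X i - X j)

theorem hHom_pairPoly (N β : ℕ) (c : ℂ) :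
    hHom N β (pairPoly N c)
      = pairProd fun i j => c • (1 : Module.End ℂ (Poly N)) + hOp N β i - hOp N β j := by
  have h : pairPoly N c = ((List.finRange N).flatMap fun i =>
      ((List.finRange N).filter fun j => i < j).map fun j => (C c + X i - X j : Poly N)).prod := by
    rw [List.flatMap_def, List.prod_flatten, List.map_map]
    rfl
  rw [h, map_list_prod, List.map_flatMap, pairProd]
  congr 2
  ext1 i
  rw [List.map_map]
  congr 1
  ext1 j
  simp [hHom_X, C_eq_smul_one]

theorem opY_eq (N β : ℕ) : opY N β = hHom N β (pairPoly N β) := (hHom_pairPoly N β β).symm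

theorem opYhat_eq (N β : ℕ) : opYhat N β = hHom N β (pairPoly N (-β)) := by
  rw [hHom_pairPoly, opYhat]
  congr 1
  ext1 i
  ext1 j
  refine LinearMap.ext fun f => ?_
  simp

/-- For adjacent indices the exchange sum of `j` is the conjugate of that of `i` plus the single
term `s_{ij}`; this term is the source of the correction `β`. -/
theorem exch_hOp_left {i j : Fin N} (h : (j : ℕ) = i + 1) (f : Poly N) :
    exch i j (hOp N β i f) = hOp N β j (exch i j f) - (β : ℂ) • f := by
  have hij : i < j := by rw [Fin.lt_def]; omega
  have hj : Finset.univ.filter (fun k => k < j) = insert i (Finset.univ.filter (fun k => k < i)) := by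
    ext k
    simp only [Finset.mem_filter, Finset.mem_univ, true_and, Finset.mem_insert, Fin.lt_def, Fin.ext_iff]
    omega
  have hs : exch i j (jmOp N i f) = jmOp N j (exch i j f) - f := by
    rw [jmOp_apply, jmOp_apply, map_sum, hj, Finset.sum_insert (by simp), exch_comm j i, exch_exch,
      add_sub_cancel_left]
    refine Finset.sum_congr rfl fun k hk => ?_
    have hk := (Finset.mem_filter.1 hk).2
    rw [exch_apply i j, rename_exch, Equiv.swap_apply_left,
      Equiv.swap_apply_of_ne_of_ne hk.ne (hk.trans hij).ne, exch_apply i j]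
  rw [hOp_apply, hOp_apply, map_add, map_smul, hs, exch_numOp_left, smul_sub]
  ring

theorem exch_hOp_right {i j : Fin N} (h : (j : ℕ) = i + 1) (f : Poly N) :
    exch i j (hOp N β j f) = hOp N β i (exch i j f) + (β : ℂ) • f := by
  have := congrArg (exch i j) (exch_hOp_left (β := β) h (exch i j f))
  rw [map_sub, map_smul, exch_exch, exch_exch] at this
  linear_combination -this

/-- As `i` and `j` are adjacent, either both or neither lie below `k`, so the exchange sum of `k` is
invariant under conjugation by `s_{ij}`. -/
theorem exch_hOp_of_ne {i j k : Fin N} (h : (j : ℕ) = i + 1) (hi : k ≠ i) (hj : k ≠ j)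
    (f : Poly N) : exch i j (hOp N β k f) = hOp N β k (exch i j f) := by
  have hs : exch i j (jmOp N k f) = jmOp N k (exch i j f) := by
    by_cases hk : i < k
    · refine exch_jmOp hk ?_ f
      rw [Fin.lt_def] at *
      rw [Ne, Fin.ext_iff] at hj
      omega
    · have hki : k < i := lt_of_le_of_ne (not_lt.1 hk) hi
      rw [jmOp_apply, jmOp_apply, map_sum]
      refine Finset.sum_congr rfl fun l hl => ?_
      have hl := (Finset.mem_filter.1 hl).2
      have hij : i < j := by rw [Fin.lt_def]; omega
      rw [exch_apply i j, rename_exch, Equiv.swap_apply_of_ne_of_ne hi hj,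
        Equiv.swap_apply_of_ne_of_ne (hl.trans hki).ne (hl.trans (hki.trans hij)).ne,
        exch_apply i j]
  rw [hOp_apply, hOp_apply, map_add, map_smul, hs, exch_numOp_of_ne hi hj]

/-- The degenerate affine Hecke relation for polynomials in the `h_i`. -/
theorem exch_hHom {i j : Fin N} (h : (j : ℕ) = i + 1) (p f : Poly N) :
    exch i j (hHom N β p f)
      = hHom N β (exch i j p) (exch i j f) - (β : ℂ) • hHom N β (divDiff i j p) f := by
  have hij : i ≠ j := by rintro rfl; omega
  induction p using MvPolynomial.induction_on generalizing f with
  | C a =>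
    have : divDiff i j (C a : Poly N) = 0 := divDiff_eq_of_mul_eq hij (by simp [exch_apply])
    rw [this]
    simp [exch_apply, C_eq_smul_one]
  | add p q hp hq =>
    simp only [map_add, LinearMap.add_apply, hp, hq, smul_add]
    ring
  | mul_X p n hp =>
    rw [mul_comm p]
    have hX : ∀ (n : Fin N) (q g : Poly N), hHom N β (X n * q) g = hOp N β n (hHom N β q g) := by
      intro n q g
      rw [map_mul, hHom_X, Module.End.mul_apply]
    rw [hX]
    rcases eq_or_ne n i with rfl | hi
    -- The defining equation of the divided difference, arranged so that the leftover term matches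
    -- the `β` correction from moving the exchange past one `h`.
    · have hd : X n * divDiff n j p + exch n j p = X j * divDiff n j p + p := by
        linear_combination divDiff_spec hij p
      rw [exch_hOp_left h, hp, exch_X_mul_left, divDiff_X_mul_left hij, hd, map_add,
        LinearMap.add_apply, hX, hX, map_sub, map_smul, smul_add]
      ring
    rcases eq_or_ne n j with rfl | hj
    · have hd : X n * divDiff i n p - exch i n p = X i * divDiff i n p - p := by
        linear_combination -divDiff_spec hij p
      rw [exch_hOp_right h, hp, exch_X_mul_right, divDiff_X_mul_right hij, hd, map_sub (hHom N β),
        LinearMap.sub_apply, hX, hX, map_sub, map_smul, smul_sub]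
      ring
    · rw [exch_hOp_of_ne h hi hj, hp, exch_X_mul_of_ne hi hj, divDiff_X_mul_of_ne hij hi hj,
        hX, hX, map_sub, map_smul]

/-! ### Symmetric and skew-symmetric polynomials under `𝒴` and `𝒴̂` -/

/-- Invariance of a polynomial under all permutations of the variables. -/
def IsSym (f : Poly N) : Prop := ∀ w : Equiv.Perm (Fin N), rename w f = f

/-- Skew-invariance of a polynomial under the permutations of the variables. -/
def IsAlt (f : Poly N) : Prop :=
  ∀ w : Equiv.Perm (Fin N), rename w f = ((Equiv.Perm.sign w : ℤ) : ℂ) • f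

theorem IsAlt.exch {f : Poly N} (hf : IsAlt f) {i j : Fin N} (h : i ≠ j) : exch i j f = -f := by
  rw [exch_apply, hf, Equiv.Perm.sign_swap h]
  simp

/-- Adjacent transpositions generate the symmetric group. This is needed because the Hecke relation
is available only for them. -/
theorem adj_induction {P : Equiv.Perm (Fin N) → Prop} (one : P 1)
    (mul : ∀ v w, P v → P w → P (v * w))
    (swap : ∀ i j : Fin N, (j : ℕ) = i + 1 → P (Equiv.swap i j)) (w : Equiv.Perm (Fin N)) : P w := by
  cases N with
  | zero => rwa [Subsingleton.elim w 1]
  | succ n =>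
    have hw : w ∈ Submonoid.closure
        (Set.range fun i : Fin n => Equiv.swap i.castSucc i.succ) := by
      rw [Equiv.Perm.mclosure_swap_castSucc_succ]; trivial
    induction hw using Submonoid.closure_induction with
    | mem x hx => obtain ⟨i, rfl⟩ := hx; exact swap _ _ (by simp)
    | one => exact one
    | mul x y _ _ hx hy => exact mul x y hx hy

theorem isSym_of_exch {f : Poly N}
    (hf : ∀ i j : Fin N, (j : ℕ) = i + 1 → exch i j f = f) : IsSym f := by
  intro w
  induction w using adj_induction with
  | one => exact rename_id_apply f
  | mul v w hv hw => rw [Equiv.Perm.coe_mul, ← rename_rename, hw, hv]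
  | swap i j h => exact hf i j h

theorem isAlt_of_exch {f : Poly N}
    (hf : ∀ i j : Fin N, (j : ℕ) = i + 1 → exch i j f = -f) : IsAlt f := by
  intro w
  induction w using adj_induction with
  | one => simp
  | mul v w hv hw =>
    rw [Equiv.Perm.coe_mul, ← rename_rename, hw, map_smul, hv, smul_smul, map_mul]
    push_cast
    rw [mul_comm]
  | swap i j h =>
    have hij : i ≠ j := by rintro rfl; omega
    rw [← exch_apply, hf i j h, Equiv.Perm.sign_swap hij]
    simp

/-- An adjacent transposition reverses the order of the pair `(i, j)` alone, so it permutes the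
remaining factors. -/
theorem pairPoly_eq_mul (c : ℂ) {i j : Fin N} (h : (j : ℕ) = i + 1) :
    ∃ q : Poly N, exch i j q = q ∧ pairPoly N c = (C c + X i - X j) * q := by
  have hij : i < j := by rw [Fin.lt_def]; omega
  set s : Finset (Fin N × Fin N) := Finset.univ.filter fun p => p.1 < p.2 with hs
  have h1 : pairPoly N c = ∏ p ∈ s, (C c + X p.1 - X p.2 : Poly N) := by
    rw [pairPoly, hs, Finset.prod_filter, Fintype.prod_prod_type]
    exact Finset.prod_congr rfl fun a _ => Finset.prod_filter _ _
  refine ⟨∏ p ∈ s.erase (i, j), (C c + X p.1 - X p.2 : Poly N), ?_, ?_⟩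
  · rw [exch_apply, map_prod]
    refine Finset.prod_equiv ((Equiv.swap i j).prodCongr (Equiv.swap i j)) ?_ (by simp)
    rintro ⟨a, b⟩
    simp only [hs, Finset.mem_erase, Finset.mem_filter, Finset.mem_univ, true_and,
      Equiv.prodCongr_apply, Prod.map, Equiv.swap_apply_def, Ne, Prod.mk.injEq]
    split_ifs <;> simp only [Fin.lt_def, Fin.ext_iff] at * <;>
      first | omega | (simp only [and_self, not_true, false_and, iff_false]; omega)
  · rw [h1, ← Finset.mul_prod_erase s _ (a := (i, j)) (by simp [hs, hij])]

/-- With `p = (β + X_i - X_j) q` and `q` invariant, the Hecke relation on a symmetric argument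
replaces `p` by `(β + X_j - X_i) q - 2β q = -p`. This is what fixes the constant `β` in the factors.
-/
theorem isAlt_opY {f : Poly N} (hf : IsSym f) : IsAlt (opY N β f) := by
  refine isAlt_of_exch fun i j h => ?_
  have hij : i ≠ j := by rintro rfl; omega
  obtain ⟨q, hq, hp⟩ := pairPoly_eq_mul (β : ℂ) h
  have hs : exch i j (pairPoly N β) = (C (β : ℂ) + X j - X i) * q := by
    rw [hp, exch_apply, map_mul, ← exch_apply i j q, hq]
    simp
  have hd : divDiff i j (pairPoly N β) = 2 * q := by
    refine divDiff_eq_of_mul_eq hij ?_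
    rw [hs, hp]
    ring
  have hc : exch i j (pairPoly N β) - C (β : ℂ) * divDiff i j (pairPoly N β) = -pairPoly N β := by
    rw [hs, hd, hp]
    ring
  have hf' : exch i j f = f := hf _
  rw [opY_eq, exch_hHom h, hf', ← LinearMap.smul_apply, ← map_smul, ← LinearMap.sub_apply,
    ← map_sub, smul_eq_C_mul, hc, map_neg, LinearMap.neg_apply]

/-- Same computation with `p = (-β + X_i - X_j) q`: the sign of the skew-symmetric argument gives
`-(-β + X_j - X_i) q - 2β q = p`. -/
theorem isSym_opYhat {f : Poly N} (hf : IsAlt f) : IsSym (opYhat N β f) := by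
  refine isSym_of_exch fun i j h => ?_
  have hij : i ≠ j := by rintro rfl; omega
  obtain ⟨q, hq, hp⟩ := pairPoly_eq_mul (-β : ℂ) h
  have hs : exch i j (pairPoly N (-β)) = (C (-β : ℂ) + X j - X i) * q := by
    rw [hp, exch_apply, map_mul, ← exch_apply i j q, hq]
    simp
  have hd : divDiff i j (pairPoly N (-β)) = 2 * q := by
    refine divDiff_eq_of_mul_eq hij ?_
    rw [hs, hp]
    ring
  have hc : -exch i j (pairPoly N (-β)) - C (β : ℂ) * divDiff i j (pairPoly N (-β))
      = pairPoly N (-β) := by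
    rw [hs, hd, hp, C_neg]
    ring
  rw [opYhat_eq, exch_hHom h, hf.exch hij, map_neg, ← LinearMap.neg_apply, ← map_neg,
    ← LinearMap.smul_apply, ← map_smul, ← LinearMap.sub_apply, ← map_sub, smul_eq_C_mul, hc]

/-! ### Gaussian integration of polynomials -/

/-- The moments of the Gaussian weight on the line. -/
def gaussMoment (n : ℕ) : ℂ := ∫ x : ℝ, (x : ℂ) ^ n * ((Real.exp (-x ^ 2) : ℝ) : ℂ)

theorem integrable_pow_mul_gauss (n : ℕ) :
    Integrable fun x : ℝ => (x : ℂ) ^ n * ((Real.exp (-x ^ 2) : ℝ) : ℂ) := by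
  have h := (integrable_rpow_mul_exp_neg_mul_sq one_pos
    (show (-1 : ℝ) < n by have : (0 : ℝ) ≤ n := n.cast_nonneg; linarith)).ofReal (𝕜 := ℂ)
  refine h.congr (Filter.Eventually.of_forall fun x => ?_)
  simp [Real.rpow_natCast]

/-- Integration by parts. For `n = 0` the truncated `n - 1` is harmless, since its coefficient
vanishes. -/
theorem two_mul_gaussMoment_succ (n : ℕ) :
    2 * gaussMoment (n + 1) = n * gaussMoment (n - 1) := by
  have hu : ∀ x : ℝ, HasDerivAt (fun x : ℝ => (x : ℂ) ^ n) (n * (x : ℂ) ^ (n - 1)) x := by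
    intro x
    have := (Complex.ofRealCLM.hasDerivAt (x := x)).pow n
    simp only [Complex.ofRealCLM_apply, Complex.ofReal_one, mul_one] at this
    exact this
  have hv : ∀ x : ℝ, HasDerivAt (fun x : ℝ => ((Real.exp (-x ^ 2) : ℝ) : ℂ))
      (-2 * x * ((Real.exp (-x ^ 2) : ℝ) : ℂ)) x := by
    intro x
    have := (hasDerivAt_pow 2 x).neg.exp.ofReal_comp
    refine this.congr_deriv ?_
    change ((Real.exp (-x ^ 2) * -((2 : ℕ) * x ^ (2 - 1)) : ℝ) : ℂ) = _
    push_cast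
    ring
  have h1 : (fun x : ℝ => (x : ℂ) ^ n * (-2 * x * ((Real.exp (-x ^ 2) : ℝ) : ℂ)))
      = fun x : ℝ => (-2) * ((x : ℂ) ^ (n + 1) * ((Real.exp (-x ^ 2) : ℝ) : ℂ)) := by
    ext x; ring
  have h2 : (fun x : ℝ => (n * (x : ℂ) ^ (n - 1)) * ((Real.exp (-x ^ 2) : ℝ) : ℂ))
      = fun x : ℝ => n * ((x : ℂ) ^ (n - 1) * ((Real.exp (-x ^ 2) : ℝ) : ℂ)) := by
    ext x; ring
  have key := integral_mul_deriv_eq_deriv_mul_of_integrable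
    (u := fun x : ℝ => (x : ℂ) ^ n) (v := fun x : ℝ => ((Real.exp (-x ^ 2) : ℝ) : ℂ))
    (u' := fun x : ℝ => n * (x : ℂ) ^ (n - 1))
    (v' := fun x : ℝ => -2 * x * ((Real.exp (-x ^ 2) : ℝ) : ℂ))
    (fun x _ => hu x) (fun x _ => hv x)
    (((integrable_pow_mul_gauss (n + 1)).const_mul (-2)).congr
      (Filter.Eventually.of_forall fun x => (congrFun h1 x).symm))
    (((integrable_pow_mul_gauss (n - 1)).const_mul n).congr
      (Filter.Eventually.of_forall fun x => (congrFun h2 x).symm))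
    (integrable_pow_mul_gauss n)
  rw [h1, h2, integral_const_mul, integral_const_mul] at key
  unfold gaussMoment
  linear_combination -key

/-- The Gaussian weight `∏ exp (-x_i²)` on `ℝ^N`. -/
def gaussWeight (N : ℕ) (x : Fin N → ℝ) : ℝ := ∏ i, Real.exp (-(x i) ^ 2)

theorem eval_monomial_mul_gaussWeight (a : Fin N →₀ ℕ) (c : ℂ) (x : Fin N → ℝ) :
    eval (fun i => (x i : ℂ)) (monomial a c) * ((gaussWeight N x : ℝ) : ℂ)
      = c * ∏ i, ((x i : ℂ) ^ a i * ((Real.exp (-(x i) ^ 2) : ℝ) : ℂ)) := by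
  rw [eval_monomial, Finsupp.prod_fintype _ _ (by simp), gaussWeight, Complex.ofReal_prod,
    Finset.prod_mul_distrib, mul_assoc]

theorem integrable_eval_mul_gaussWeight (f : Poly N) :
    Integrable fun x : Fin N → ℝ =>
      eval (fun i => (x i : ℂ)) f * ((gaussWeight N x : ℝ) : ℂ) := by
  induction f using MvPolynomial.induction_on' with
  | monomial a c =>
    simp only [eval_monomial_mul_gaussWeight]
    exact (Integrable.fintype_prod (f := fun i (t : ℝ) => (t : ℂ) ^ a i *
      ((Real.exp (-t ^ 2) : ℝ) : ℂ)) fun i => integrable_pow_mul_gauss (a i)).const_mul c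
  | add p q hp hq =>
    simp only [map_add, add_mul]
    exact hp.add hq

/-- Integration of polynomials against the Gaussian weight. -/
def gaussInt (N : ℕ) : Poly N →ₗ[ℂ] ℂ where
  toFun f := ∫ x : Fin N → ℝ, eval (fun i => (x i : ℂ)) f * ((gaussWeight N x : ℝ) : ℂ)
  map_add' f g := by
    simp only [map_add, add_mul]
    exact integral_add (integrable_eval_mul_gaussWeight f) (integrable_eval_mul_gaussWeight g)
  map_smul' c f := by
    simp only [smul_eval, mul_assoc, RingHom.id_apply, smul_eq_mul]
    exact integral_const_mul _ _

theorem gaussInt_apply (f : Poly N) : gaussInt N f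
    = ∫ x : Fin N → ℝ, eval (fun i => (x i : ℂ)) f * ((gaussWeight N x : ℝ) : ℂ) := rfl

theorem gaussInt_monomial (a : Fin N →₀ ℕ) (c : ℂ) :
    gaussInt N (monomial a c) = c * ∏ i, gaussMoment (a i) := by
  simp only [gaussInt_apply, eval_monomial_mul_gaussWeight]
  rw [integral_const_mul, integral_fintype_prod_volume_eq_prod
    (f := fun i (t : ℝ) => (t : ℂ) ^ a i * ((Real.exp (-t ^ 2) : ℝ) : ℂ))]
  rfl

theorem gaussInt_rename (w : Equiv.Perm (Fin N)) (f : Poly N) :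
    gaussInt N (rename w f) = gaussInt N f := by
  induction f using MvPolynomial.induction_on' with
  | monomial a c =>
    rw [rename_monomial, gaussInt_monomial, gaussInt_monomial]
    congr 1
    refine (Fintype.prod_equiv w _ _ fun i => ?_).symm
    rw [Finsupp.mapDomain_apply w.injective]
  | add p q hp hq => rw [map_add, map_add, map_add, hp, hq]

theorem gaussInt_pderiv (i : Fin N) (f : Poly N) :
    gaussInt N (pderiv i f) = 2 * gaussInt N (X i * f) := by
  induction f using MvPolynomial.induction_on' with
  | monomial a c =>
    have h1 : ∏ k, gaussMoment ((a - Finsupp.single i 1 : Fin N →₀ ℕ) k)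
        = gaussMoment (a i - 1) * ∏ k ∈ Finset.univ.erase i, gaussMoment (a k) := by
      rw [← Finset.mul_prod_erase Finset.univ _ (Finset.mem_univ i)]
      congr 1
      · simp
      · refine Finset.prod_congr rfl fun k hk => ?_
        simp [Finsupp.single_eq_of_ne (Finset.ne_of_mem_erase hk)]
    have h2 : ∏ k, gaussMoment ((Finsupp.single i 1 + a : Fin N →₀ ℕ) k)
        = gaussMoment (a i + 1) * ∏ k ∈ Finset.univ.erase i, gaussMoment (a k) := by
      rw [← Finset.mul_prod_erase Finset.univ _ (Finset.mem_univ i)]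
      congr 1
      · simp [add_comm]
      · refine Finset.prod_congr rfl fun k hk => ?_
        simp [Finsupp.single_eq_of_ne (Finset.ne_of_mem_erase hk)]
    rw [pderiv_monomial, X, monomial_mul, gaussInt_monomial, gaussInt_monomial, h1, h2]
    linear_combination -c * (∏ k ∈ Finset.univ.erase i, gaussMoment (a k))
      * two_mul_gaussMoment_succ (a i)
  | add p q hp hq => rw [map_add, map_add, hp, hq, mul_add, map_add, mul_add]

theorem gaussWeight_pos (x : Fin N → ℝ) : 0 < gaussWeight N x :=
  Finset.prod_pos fun _ _ => Real.exp_pos _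

theorem eval_map_conj (f : Poly N) (x : Fin N → ℝ) :
    eval (fun i => (x i : ℂ)) (map (starRingEnd ℂ) f)
      = starRingEnd ℂ (eval (fun i => (x i : ℂ)) f) := by
  rw [eval_map, ← eval₂_id, ← RingHom.comp_id (starRingEnd ℂ), hom_eval₂]
  simp

/-- The integrand is `|f|²` times a positive weight, continuous and nonnegative, so a zero integral
makes `f` vanish on `ℝ^N`. A polynomial vanishing on a product of infinite sets is zero. -/
theorem eq_zero_of_gaussInt_conj_mul_self {f : Poly N}
    (h : gaussInt N (map (starRingEnd ℂ) f * f) = 0) : f = 0 := by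
  set r : (Fin N → ℝ) → ℝ := fun x =>
    Complex.normSq (eval (fun i => (x i : ℂ)) f) * gaussWeight N x with hr
  have he : ∀ x : Fin N → ℝ, eval (fun i => (x i : ℂ)) (map (starRingEnd ℂ) f * f)
      * ((gaussWeight N x : ℝ) : ℂ) = ((r x : ℝ) : ℂ) := by
    intro x
    rw [map_mul, eval_map_conj, mul_comm (starRingEnd ℂ _), Complex.mul_conj, hr]
    push_cast
    rfl
  have hc : Continuous fun x : Fin N → ℝ => eval (fun i => (x i : ℂ)) f :=
    (MvPolynomial.continuous_eval f).comp (by fun_prop)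
  have hcont : Continuous r := by
    refine (Complex.continuous_normSq.comp hc).mul ?_
    unfold gaussWeight
    fun_prop
  have hint : Integrable r := by
    have := (integrable_eval_mul_gaussWeight (map (starRingEnd ℂ) f * f)).re
    refine this.congr (Filter.Eventually.of_forall fun x => ?_)
    simp only [he]
    simp
  have hnn : 0 ≤ r := fun x => mul_nonneg (Complex.normSq_nonneg _) (gaussWeight_pos x).le
  have hzero : ∫ x, r x = 0 := by
    rw [gaussInt_apply] at h
    simp only [he] at h
    rw [integral_complex_ofReal] at h
    exact_mod_cast h
  have hr0 : r = 0 := by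
    have := (integral_eq_zero_iff_of_nonneg hnn hint).1 hzero
    exact (Continuous.ae_eq_iff_eq volume hcont continuous_const).1 this
  refine MvPolynomial.funext_set (fun _ => Set.range ((↑) : ℝ → ℂ))
    (fun _ => Set.infinite_range_of_injective Complex.ofReal_injective) fun z hz => ?_
  choose x hx using fun i => hz i (Set.mem_univ i)
  obtain rfl : (fun i => (x i : ℂ)) = z := funext hx
  have := congrFun hr0 x
  simp only [hr, Pi.zero_apply, mul_eq_zero, Complex.normSq_eq_zero,
    (gaussWeight_pos x).ne', or_false] at this
  rw [this, map_zero]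

/-! ### The scalar product and self-adjointness of the `h_i` -/

/-- Squaring removes the absolute values, so every pairing becomes a Gaussian integral of a
polynomial. -/
theorem groundState_sq (x : Fin N → ℝ) :
    ((groundState N β x : ℝ) : ℂ) ^ 2
      = eval (fun i => (x i : ℂ)) (vand N ^ (2 * β)) * ((gaussWeight N x : ℝ) : ℂ) := by
  have h1 : (∏ j : Fin N, Real.exp (-(x j) ^ 2 / 2)) ^ 2 = gaussWeight N x := by
    rw [gaussWeight, ← Finset.prod_pow]
    refine Finset.prod_congr rfl fun i _ => ?_
    rw [← Real.exp_nat_mul]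
    congr 1
    push_cast
    ring
  have h2 : (∏ j : Fin N, ∏ k ∈ Finset.univ.filter (fun k => j < k), |x j - x k| ^ β) ^ 2
      = (∏ j : Fin N, ∏ k ∈ Finset.univ.filter (fun k => j < k), (x j - x k)) ^ (2 * β) := by
    simp only [← Finset.prod_pow]
    refine Finset.prod_congr rfl fun i _ => Finset.prod_congr rfl fun j _ => ?_
    rw [← pow_mul, mul_comm β, pow_mul, sq_abs, pow_mul]
  rw [groundState, ← Complex.ofReal_pow, mul_pow, h1, h2, vand]
  push_cast
  simp

theorem scal_eq (f g : Poly N) : scal N β f g = gaussInt N (f * g * vand N ^ (2 * β)) := by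
  rw [gaussInt_apply]
  refine integral_congr_ae (Filter.Eventually.of_forall fun x => ?_)
  simp only [groundState_sq, map_mul]
  ring

theorem vand_ne_zero (N : ℕ) : vand N ≠ 0 :=
  Finset.prod_ne_zero_iff.2 fun _ _ => Finset.prod_ne_zero_iff.2 fun _ hj =>
    X_sub_X_ne_zero (Finset.mem_filter.1 hj).2.ne

/-- The pairing is bilinear, not Hermitian, so positivity is available only against the conjugate
polynomial. -/
theorem eq_zero_of_scal_conj_self {f : Poly N} (h : scal N β f (map (starRingEnd ℂ) f) = 0) :
    f = 0 := by
  have hv : map (starRingEnd ℂ) (vand N) = vand N := by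
    simp [vand, map_prod]
  rw [scal_eq] at h
  have h0 : f * vand N ^ β = 0 := by
    refine eq_zero_of_gaussInt_conj_mul_self ?_
    rw [← h, map_mul (map _), map_pow (map _), hv]
    congr 1
    ring
  exact (mul_eq_zero.1 h0).resolve_right (pow_ne_zero _ (vand_ne_zero N))

theorem isAlt_vand (N : ℕ) : IsAlt (vand N) := by
  refine isAlt_of_exch fun i j h => ?_
  have hv : vand N = pairPoly N 0 := by simp [vand, pairPoly]
  obtain ⟨q, hq, hp⟩ := pairPoly_eq_mul (0 : ℂ) h
  rw [hv, hp, exch_apply, map_mul, ← exch_apply i j q, hq]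
  simp
  ring

theorem scal_rename (w : Equiv.Perm (Fin N)) (f g : Poly N) :
    scal N β (rename w f) (rename w g) = scal N β f g := by
  have hs : rename w (vand N ^ (2 * β)) = vand N ^ (2 * β) := by
    rw [map_pow, isAlt_vand N w, pow_mul, pow_mul, smul_pow]
    rcases Int.units_eq_one_or (Equiv.Perm.sign w) with h | h <;> simp [h]
  rw [scal_eq, scal_eq, ← gaussInt_rename w (f * g * _), map_mul (rename w), map_mul (rename w), hs]

theorem vand_eq_prod (N : ℕ) : vand N
    = ∏ p ∈ Finset.univ.filter (fun p : Fin N × Fin N => p.1 < p.2), (X p.1 - X p.2) := by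
  rw [vand, Finset.prod_filter, Fintype.prod_prod_type]
  exact Finset.prod_congr rfl fun a _ => Finset.prod_filter _ _

theorem X_sub_X_dvd_of_isAlt {f : Poly N} (hf : IsAlt f) {i j : Fin N} (h : i ≠ j) :
    (X i - X j : Poly N) ∣ f := by
  have h2 : f = C (1 / 2 : ℂ) * (f - exch i j f) := by
    have hC : (C (1 / 2 : ℂ) : Poly N) * 2 = 1 := by
      rw [show (2 : Poly N) = C 2 from (map_ofNat C 2).symm, ← C_mul]
      norm_num
    rw [hf.exch h]
    linear_combination -f * hC
  rw [h2]
  exact Dvd.dvd.mul_left (X_sub_X_dvd i j f) _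

theorem pderiv_prod {ι : Type*} [DecidableEq ι] (i : Fin N) (s : Finset ι) (f : ι → Poly N) :
    pderiv i (∏ a ∈ s, f a) = ∑ a ∈ s, (∏ b ∈ s.erase a, f b) * pderiv i (f a) := by
  induction s using Finset.induction_on with
  | empty => simp
  | insert a s ha ih =>
    rw [Finset.prod_insert ha, Finset.sum_insert ha, Finset.erase_insert ha, pderiv_mul, ih,
      Finset.mul_sum, mul_comm (pderiv i (f a))]
    congr 1
    refine Finset.sum_congr rfl fun b hb => ?_
    have hab : a ≠ b := by rintro rfl; exact ha hb
    rw [Finset.erase_insert_of_ne hab, Finset.prod_insert (by simp [ha]), mul_assoc]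

/-- The logarithmic derivative of the Vandermonde product, kept inside the polynomial ring: `U k`
stands for `𝒳 / (x_i - x_k)`. -/
theorem exists_pderiv_vand (i : Fin N) : ∃ U : Fin N → Poly N,
    (∀ k, k ≠ i → (X i - X k) * U k = vand N) ∧
    pderiv i (vand N) = ∑ k ∈ Finset.univ.filter (fun k => k ≠ i), U k := by
  have hex : ∀ a b : Fin N, ∃ u : Poly N, a ≠ b → (X a - X b) * u = vand N := by
    intro a b
    by_cases h : a = b
    · exact ⟨0, fun h' => absurd h h'⟩
    · obtain ⟨u, hu⟩ := X_sub_X_dvd_of_isAlt (isAlt_vand N) h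
      exact ⟨u, fun _ => hu.symm⟩
  choose U hU using hex
  refine ⟨U i, fun k hk => hU i k hk.symm, ?_⟩
  have hanti : ∀ a b : Fin N, a ≠ b → U b a = -U a b := fun a b h =>
    mul_left_cancel₀ (X_sub_X_ne_zero h.symm) (by rw [hU b a h.symm]; linear_combination -hU a b h)
  have herase : ∀ p ∈ Finset.univ.filter (fun p : Fin N × Fin N => p.1 < p.2),
      ∏ q ∈ (Finset.univ.filter (fun p : Fin N × Fin N => p.1 < p.2)).erase p,
        (X q.1 - X q.2 : Poly N) = U p.1 p.2 := by
    intro p hp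
    have hp' := (Finset.mem_filter.1 hp).2.ne
    refine mul_left_cancel₀ (X_sub_X_ne_zero hp') ?_
    rw [Finset.mul_prod_erase _ (fun q : Fin N × Fin N => (X q.1 - X q.2 : Poly N)) hp, hU _ _ hp',
      vand_eq_prod]
  rw [vand_eq_prod, pderiv_prod]
  rw [Finset.sum_congr rfl fun p hp => by rw [herase p hp]]
  rw [Finset.sum_filter, Fintype.sum_prod_type]
  have hs : ∀ a b : Fin N, (if a < b then U a b * (pderiv i) (X a - X b : Poly N) else 0)
      = (if a = i then (if i < b then U i b else 0) else 0)
        + (if b = i then (if a < i then U i a else 0) else 0) := by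
    intro a b
    by_cases hab : a < b
    · rw [if_pos hab, map_sub, pderiv_X, pderiv_X]
      by_cases ha : a = i
      · subst ha
        simp [hab, hab.ne']
      · by_cases hb : b = i
        · subst hb
          simp [hab, hab.ne, hanti a b hab.ne]
        · simp [ha, hb]
    · rw [if_neg hab]
      by_cases ha : a = i
      · subst ha
        by_cases hb : b = a
        · subst hb; simp
        · simp [hab, hb]
      · by_cases hb : b = i
        · subst hb
          simp [hab, ha]
        · simp [ha, hb]
  simp only [hs, Finset.sum_add_distrib]
  rw [Finset.sum_comm]
  simp only [Finset.sum_ite_eq', Finset.mem_univ, if_true]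
  rw [← Finset.sum_add_distrib, Finset.sum_filter]
  refine Finset.sum_congr rfl fun k _ => ?_
  rcases lt_trichotomy i k with h | h | h
  · simp [h, h.ne', h.not_gt]
  · simp [h]
  · simp [h, h.ne, h.not_gt]

theorem gaussInt_eq_zero_of_exch {i k : Fin N} {f : Poly N} (h : exch i k f = -f) :
    gaussInt N f = 0 := by
  have := gaussInt_rename (Equiv.swap i k) f
  rw [← exch_apply, h, map_neg] at this
  exact self_eq_neg.1 this.symm

/-- After clearing the divided differences, the integrand is `-(s f · g + f · s g) E` with `s` the
exchange. The bracket is invariant under `s` and `E = V / (x_i - x_k)` changes sign, so the integral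
is zero. -/
theorem gaussInt_divDiff {i k : Fin N} (h : k ≠ i) {E V : Poly N} (hE : (X i - X k) * E = V)
    (hV : exch i k V = V) (f g : Poly N) :
    gaussInt N ((divDiff i k f * g + f * divDiff i k g) * V - 2 * (f * g * E)) = 0 := by
  have hsE : exch i k E = -E := by
    refine mul_left_cancel₀ (X_sub_X_ne_zero h) ?_
    have h1 := congrArg (exch i k) hE
    rw [hV, exch_apply, map_mul, map_sub, rename_X, rename_X, Equiv.swap_apply_left,
      Equiv.swap_apply_right, ← exch_apply] at h1
    rw [h1]
    linear_combination -hE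
  have h1 : (divDiff i k f * g + f * divDiff i k g) * V - 2 * (f * g * E)
      = -(exch i k f * g + f * exch i k g) * E := by
    rw [← hE]
    linear_combination g * E * divDiff_spec h.symm f + f * E * divDiff_spec h.symm g
  refine gaussInt_eq_zero_of_exch (i := i) (k := k) ?_
  rw [h1, exch_apply, map_mul, map_neg, map_add, map_mul, map_mul]
  simp only [← exch_apply, exch_exch, hsE]
  ring

theorem exch_vand_pow (i k : Fin N) : exch i k (vand N ^ (2 * β)) = vand N ^ (2 * β) := by
  rcases eq_or_ne i k with rfl | h
  · rw [exch_apply, Equiv.swap_self]; exact rename_id_apply _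
  · rw [exch_apply, map_pow, ← exch_apply, (isAlt_vand N).exch h, pow_mul, neg_sq, ← pow_mul]

/-- The adjoint of `D_i` is `2 x_i - D_i`: the derivative of the Vandermonde power is cancelled by
the divided differences through `gaussInt_divDiff`. -/
theorem scal_dunkl (i : Fin N) (f g : Poly N) :
    scal N β (dunkl N β i f) g = scal N β f (2 * (X i * g) - dunkl N β i g) := by
  rw [scal_eq, scal_eq]
  have hp := gaussInt_pderiv i (f * g * vand N ^ (2 * β))
  -- For `β = 0` the weight `𝒳^0` is not divisible by `x_i - x_k`, and there are no divided
  -- differences to treat.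
  rcases β with _ | b
  · have h0 : ∀ f : Poly N, dunkl N 0 i f = pderiv i f := fun f => by simp [dunkl_apply]
    simp only [h0, mul_zero, pow_zero, mul_one] at hp ⊢
    rw [pderiv_mul, map_add] at hp
    rw [mul_sub, map_sub, show f * (2 * (X i * g)) = (2 : ℂ) • (X i * (f * g)) by
      rw [smul_eq_C_mul, map_ofNat]; ring, map_smul, smul_eq_mul]
    linear_combination hp
  obtain ⟨U, hU, hV⟩ := exists_pderiv_vand i
  set V := vand N ^ (2 * (b + 1)) with hVdef
  have hE : ∀ k, k ≠ i → (X i - X k) * (U k * vand N ^ (2 * b + 1)) = V := fun k hk => by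
    rw [← mul_assoc, hU k hk, hVdef]; ring
  have hdV : pderiv i V = ((b + 1 : ℕ) : ℂ) • ∑ k ∈ Finset.univ.filter (fun k => k ≠ i),
      2 * (U k * vand N ^ (2 * b + 1)) := by
    rw [hVdef, Derivation.leibniz_pow, hV, ← Finset.mul_sum, ← Finset.sum_mul]
    simp only [smul_eq_C_mul, nsmul_eq_mul, smul_eq_mul, map_natCast]
    push_cast
    rw [show 2 * (b + 1) - 1 = 2 * b + 1 by omega]
    ring
  have hsum : gaussInt N (((b + 1 : ℕ) : ℂ) • ∑ k ∈ Finset.univ.filter (fun k => k ≠ i),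
      ((divDiff i k f * g + f * divDiff i k g) * V
        - 2 * (f * g * (U k * vand N ^ (2 * b + 1))))) = 0 := by
    rw [map_smul, map_sum, Finset.sum_eq_zero, smul_zero]
    intro k hk
    have hk := (Finset.mem_filter.1 hk).2
    exact gaussInt_divDiff hk (hE k hk) (exch_vand_pow i k) f g
  have hpoly : dunkl N (b + 1) i f * g * V - f * (2 * (X i * g) - dunkl N (b + 1) i g) * V
      = pderiv i (f * g * V) - (2 : ℂ) • (X i * (f * g * V))
        + ((b + 1 : ℕ) : ℂ) • ∑ k ∈ Finset.univ.filter (fun k => k ≠ i),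
      ((divDiff i k f * g + f * divDiff i k g) * V
        - 2 * (f * g * (U k * vand N ^ (2 * b + 1)))) := by
    rw [pderiv_mul, pderiv_mul, hdV, dunkl_apply, dunkl_apply, Finset.sum_sub_distrib]
    simp only [← Finset.mul_sum, ← Finset.sum_mul, Finset.sum_add_distrib, smul_eq_C_mul, map_ofNat]
    ring
  have := congrArg (gaussInt N) hpoly
  rw [map_add, hsum, map_sub, map_sub, map_smul, smul_eq_mul, hp] at this
  linear_combination this

theorem scal_comm (f g : Poly N) : scal N β f g = scal N β g f := by
  rw [scal_eq, scal_eq, mul_comm f]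

/-- The pairing `scal` as a bilinear form. -/
def scalForm (N β : ℕ) : Poly N →ₗ[ℂ] Poly N →ₗ[ℂ] ℂ :=
  LinearMap.mk₂ ℂ (scal N β)
    (fun f g h => by simp only [scal_eq, add_mul, map_add])
    (fun c f g => by simp only [scal_eq, smul_mul_assoc, map_smul])
    (fun f g h => by simp only [scal_eq, mul_add, add_mul, map_add])
    (fun c f g => by simp only [scal_eq, mul_smul_comm, smul_mul_assoc, map_smul])

theorem scalForm_apply (f g : Poly N) : scalForm N β f g = scal N β f g := rfl

theorem scalForm_dunkl (i : Fin N) (f g : Poly N) :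
    scalForm N β (dunkl N β i f) g
      = (2 : ℂ) * scalForm N β f (X i * g) - scalForm N β f (dunkl N β i g) := by
  rw [scalForm_apply, scal_dunkl, ← scalForm_apply, map_sub,
    show (2 * (X i * g) : Poly N) = (2 : ℂ) • (X i * g) by rw [smul_eq_C_mul, map_ofNat], map_smul,
    smul_eq_mul]

theorem scal_X_mul (i : Fin N) (f g : Poly N) :
    scalForm N β (X i * f) g = scalForm N β f (X i * g) := by
  simp only [scalForm_apply, scal_eq]
  congr 1
  ring

/-- The right side is symmetric in `f` and `g`, which makes `a†_i a_i` self-adjoint. -/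
theorem scal_numOp (i : Fin N) (f g : Poly N) :
    scalForm N β (numOp N β i f) g = (1 / 2 : ℂ) * scalForm N β (dunkl N β i f) (dunkl N β i g) := by
  rw [numOp_apply, map_sub, LinearMap.sub_apply, scal_X_mul, map_smul, LinearMap.smul_apply,
    scalForm_dunkl i (dunkl N β i f), smul_eq_mul]
  ring

theorem scal_exch (j k : Fin N) (f g : Poly N) :
    scalForm N β (exch j k f) g = scalForm N β f (exch j k g) := by
  have := scal_rename (β := β) (Equiv.swap j k) f (exch j k g)
  rwa [← exch_apply, ← exch_apply, exch_exch] at this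

theorem scal_hOp (i : Fin N) (f g : Poly N) :
    scalForm N β (hOp N β i f) g = scalForm N β f (hOp N β i g) := by
  have hn : scalForm N β (numOp N β i f) g = scalForm N β f (numOp N β i g) := by
    rw [scal_numOp, scalForm_apply f, scal_comm, ← scalForm_apply, scal_numOp, scalForm_apply,
      scal_comm, ← scalForm_apply]
  have hj : scalForm N β (jmOp N i f) g = scalForm N β f (jmOp N i g) := by
    simp only [jmOp_apply, map_sum, LinearMap.sum_apply, scal_exch]
  rw [hOp_apply, hOp_apply, map_add, map_add, LinearMap.add_apply, hn, map_smul, map_smul,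
    LinearMap.smul_apply, hj]

theorem scal_hHom (p f g : Poly N) :
    scalForm N β (hHom N β p f) g = scalForm N β f (hHom N β p g) := by
  induction p using MvPolynomial.induction_on generalizing f g with
  | C a =>
    simp [C_eq_smul_one]
  | add p q hp hq =>
    simp only [map_add, LinearMap.add_apply, hp, hq]
  | mul_X p n hp =>
    conv_rhs => rw [mul_comm]
    rw [map_mul, map_mul, hHom_X, Module.End.mul_apply, Module.End.mul_apply, hp, scal_hOp]

/-! ### Partial degrees and stability of `lowPoly` under the `h_i` -/

/-- The substitution `x_i ↦ t x_i` for `i ∈ S`. -/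
def degHom (S : Finset (Fin N)) : Poly N →ₐ[ℂ] Polynomial (Poly N) :=
  aeval fun i => Polynomial.monomial (if i ∈ S then 1 else 0) (X i : Poly N)

theorem degHom_monomial (S : Finset (Fin N)) (a : Fin N →₀ ℕ) (c : ℂ) :
    degHom S (monomial a c) = Polynomial.monomial (∑ i ∈ S, a i) (monomial a c) := by
  have hp : ∀ T : Finset (Fin N), ∏ i ∈ T, (Polynomial.monomial (if i ∈ S then 1 else 0)
      (X i : Poly N)) ^ a i
      = Polynomial.monomial (∑ i ∈ T, if i ∈ S then a i else 0) (∏ i ∈ T, (X i : Poly N) ^ a i) := by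
    intro T
    induction T using Finset.induction_on with
    | empty => simp
    | insert i T hi ih =>
      rw [Finset.prod_insert hi, ih, Polynomial.monomial_pow, Polynomial.monomial_mul_monomial,
        Finset.sum_insert hi, Finset.prod_insert hi]
      congr 2
      split_ifs <;> simp
  rw [degHom, aeval_monomial, Finsupp.prod_fintype _ _ (by simp), hp, monomial_eq,
    Finsupp.prod_fintype _ _ (by simp), Finset.sum_ite_mem, Finset.univ_inter]
  rw [show algebraMap ℂ (Polynomial (Poly N)) c = Polynomial.C (C c) from rfl,
    Polynomial.C_mul_monomial]

theorem coeff_degHom (S : Finset (Fin N)) (f : Poly N) (a : Fin N →₀ ℕ) (n : ℕ) :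
    coeff a ((degHom S f).coeff n) = if ∑ i ∈ S, a i = n then coeff a f else 0 := by
  induction f using MvPolynomial.induction_on' with
  | monomial b c =>
    rw [degHom_monomial, Polynomial.coeff_monomial]
    by_cases hb : b = a
    · subst hb
      split_ifs <;> simp
    · split_ifs <;> simp [coeff_monomial, hb]
  | add p q hp hq =>
    rw [map_add, Polynomial.coeff_add, coeff_add, hp, hq, coeff_add]
    split_ifs <;> simp

/-- The degree of a polynomial in the variables `x_i`, `i ∈ S`. -/
def partialDeg (S : Finset (Fin N)) (f : Poly N) : ℕ := (degHom S f).natDegree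

theorem partialDeg_le_iff {S : Finset (Fin N)} {f : Poly N} {d : ℕ} :
    partialDeg S f ≤ d ↔ ∀ a, coeff a f ≠ 0 → ∑ i ∈ S, a i ≤ d := by
  rw [partialDeg, Polynomial.natDegree_le_iff_coeff_eq_zero]
  constructor
  · intro h a ha
    by_contra hd
    have := coeff_degHom S f a (∑ i ∈ S, a i)
    rw [h _ (not_le.1 hd), if_pos rfl, coeff_zero] at this
    exact ha this.symm
  · intro h n hn
    ext a
    rw [coeff_degHom, coeff_zero]
    split_ifs with hs
    · by_contra ha
      exact absurd (h a ha) (by omega)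
    · rfl

theorem sum_le_partialDeg (S : Finset (Fin N)) {f : Poly N} {a : Fin N →₀ ℕ} (h : coeff a f ≠ 0) :
    ∑ i ∈ S, a i ≤ partialDeg S f := partialDeg_le_iff.1 le_rfl a h

theorem degHom_ne_zero (S : Finset (Fin N)) {f : Poly N} (h : f ≠ 0) : degHom S f ≠ 0 := by
  obtain ⟨a, ha⟩ := ne_zero_iff.1 h
  intro h0
  have := coeff_degHom S f a (∑ i ∈ S, a i)
  rw [h0, if_pos rfl] at this
  exact ha (by simpa using this.symm)

theorem partialDeg_mul (S : Finset (Fin N)) {f g : Poly N} (hf : f ≠ 0) (hg : g ≠ 0) :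
    partialDeg S (f * g) = partialDeg S f + partialDeg S g := by
  rw [partialDeg, map_mul, Polynomial.natDegree_mul (degHom_ne_zero S hf) (degHom_ne_zero S hg)]
  rfl

theorem partialDeg_one (S : Finset (Fin N)) : partialDeg S (1 : Poly N) = 0 := by
  simp [partialDeg]

theorem partialDeg_X_le (S : Finset (Fin N)) {i k : Fin N} (h : i ≠ k) :
    partialDeg S (X i : Poly N) ≤ partialDeg S (X i - X k : Poly N) := by
  refine partialDeg_le_iff.2 fun a ha => ?_
  rw [coeff_X] at ha
  have ha' : Finsupp.single i 1 = a := by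
    by_contra hne
    exact ha (if_neg hne)
  subst ha'
  refine sum_le_partialDeg S ?_
  rw [coeff_sub, coeff_X, coeff_X, if_neg fun e => h (Finsupp.single_left_injective one_ne_zero e).symm]
  simp

/-- The sum of the first `k` entries. -/
def headSum (ν : Fin N → ℕ) (k : ℕ) : ℕ := ∑ i ∈ Finset.univ.filter (fun i : Fin N => (i : ℕ) < k), ν i

/-- The polynomials all of whose exponents have their rearrangement dominated by `ν`. -/
def lowPoly (ν : Fin N → ℕ) : Submodule ℂ (Poly N) where
  carrier := {f | ∀ a, coeff a f ≠ 0 → ∀ S : Finset (Fin N), ∑ i ∈ S, a i ≤ headSum ν S.card}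
  zero_mem' := fun a ha => absurd (coeff_zero a) ha
  add_mem' := fun {f g} hf hg a ha => by
    by_cases h : coeff a f = 0
    · refine hg a fun h' => ha ?_
      rw [coeff_add, h, h', add_zero]
    · exact hf a h
  smul_mem' := fun c f hf a ha => hf a fun h => ha (by rw [coeff_smul, h, smul_zero])

variable {ν : Fin N → ℕ}

theorem mem_lowPoly {f : Poly N} : f ∈ lowPoly ν ↔
    ∀ a, coeff a f ≠ 0 → ∀ S : Finset (Fin N), ∑ i ∈ S, a i ≤ headSum ν S.card := Iff.rfl

theorem mem_lowPoly_iff_partialDeg {f : Poly N} :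
    f ∈ lowPoly ν ↔ ∀ S : Finset (Fin N), partialDeg S f ≤ headSum ν S.card := by
  rw [mem_lowPoly]
  simp only [partialDeg_le_iff]
  exact ⟨fun h S a ha => h a ha S, fun h a ha S => h S a ha⟩

/-- The exponent with given entries. -/
abbrev expo (a : Fin N → ℕ) : Fin N →₀ ℕ := Finsupp.equivFunOnFinite.symm a

theorem coeff_rename_perm (w : Equiv.Perm (Fin N)) (f : Poly N) (a : Fin N →₀ ℕ) :
    coeff a (rename w f) = coeff (expo (a ∘ w)) f := by
  have ha : a = Finsupp.mapDomain w (expo (a ∘ w)) := by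
    ext i
    obtain ⟨j, rfl⟩ := w.surjective i
    rw [Finsupp.mapDomain_apply w.injective]
    simp
  conv_lhs => rw [ha]
  exact coeff_rename_mapDomain _ w.injective _ _

theorem rename_mem_lowPoly (w : Equiv.Perm (Fin N)) {f : Poly N} (hf : f ∈ lowPoly ν) :
    rename w f ∈ lowPoly ν := by
  intro a ha S
  rw [coeff_rename_perm] at ha
  have := hf _ ha (S.map w.symm.toEmbedding)
  rw [Finset.card_map, Finset.sum_map] at this
  simpa using this

/-- Partial degrees add over a domain, so a factor may be replaced by one of no larger partial
degrees. With `p = x_i - x_k` and `q` equal to `1` or `x_i`, this controls divided differences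
without a formula on monomials. -/
theorem mul_mem_lowPoly_of_mul_mem {p q u : Poly N} (hp : p ≠ 0)
    (hq : ∀ S, partialDeg S q ≤ partialDeg S p) (h : p * u ∈ lowPoly ν) : q * u ∈ lowPoly ν := by
  rcases eq_or_ne u 0 with rfl | hu
  · simp
  rcases eq_or_ne q 0 with rfl | hq0
  · simp
  rw [mem_lowPoly_iff_partialDeg] at h ⊢
  intro S
  have := h S
  rw [partialDeg_mul S hp hu] at this
  rw [partialDeg_mul S hq0 hu]
  have := hq S
  omega

theorem sub_exch_mem_lowPoly (i k : Fin N) {f : Poly N} (hf : f ∈ lowPoly ν) :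
    f - exch i k f ∈ lowPoly ν := sub_mem hf (rename_mem_lowPoly _ hf)

theorem divDiff_mem_lowPoly {i k : Fin N} (h : i ≠ k) {f : Poly N} (hf : f ∈ lowPoly ν) :
    divDiff i k f ∈ lowPoly ν := by
  have := mul_mem_lowPoly_of_mul_mem (q := 1) (u := divDiff i k f) (X_sub_X_ne_zero h)
    (fun S => by simp [partialDeg_one]) (by rw [divDiff_spec h]; exact sub_exch_mem_lowPoly i k hf)
  rwa [one_mul] at this

theorem X_mul_divDiff_mem_lowPoly {i k : Fin N} (h : i ≠ k) {f : Poly N} (hf : f ∈ lowPoly ν) :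
    X i * divDiff i k f ∈ lowPoly ν :=
  mul_mem_lowPoly_of_mul_mem (X_sub_X_ne_zero h) (fun S => partialDeg_X_le S h)
    (by rw [divDiff_spec h]; exact sub_exch_mem_lowPoly i k hf)

theorem coeff_pderiv_add (i : Fin N) (f : Poly N) (a : Fin N →₀ ℕ) :
    coeff a (pderiv i f) = (a i + 1) * coeff (a + Finsupp.single i 1) f := by
  induction f using MvPolynomial.induction_on' with
  | monomial b c =>
    rw [pderiv_monomial, coeff_monomial, coeff_monomial]
    by_cases hb : b = a + Finsupp.single i 1
    · subst hb
      simp [mul_comm]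
    · rw [if_neg hb, mul_zero]
      by_cases hi : b i = 0
      · simp [hi]
      · refine if_neg fun h => hb ?_
        rw [← h]
        ext j
        by_cases hj : j = i
        · subst hj
          simp
          omega
        · simp [Finsupp.single_eq_of_ne hj]
  | add p q hp hq => rw [map_add, coeff_add, coeff_add, hp, hq, mul_add]

theorem coeff_X_mul_pderiv (i : Fin N) (f : Poly N) (a : Fin N →₀ ℕ) :
    coeff a (X i * pderiv i f) = a i * coeff a f := by
  rw [coeff_X_mul']
  split_ifs with hi
  · have hi' : 1 ≤ a i := Nat.one_le_iff_ne_zero.2 (Finsupp.mem_support_iff.1 hi)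
    rw [coeff_pderiv_add, tsub_add_cancel_of_le (Finsupp.single_le_iff.2 hi')]
    simp [Nat.cast_sub hi']
  · rw [Finsupp.notMem_support_iff.1 hi]
    simp

theorem pderiv_mem_lowPoly (i : Fin N) {f : Poly N} (hf : f ∈ lowPoly ν) :
    pderiv i f ∈ lowPoly ν := by
  intro a ha S
  rw [coeff_pderiv_add] at ha
  refine le_trans (Finset.sum_le_sum fun j _ => ?_) (hf _ (right_ne_zero_of_mul ha) S)
  simp

theorem X_mul_pderiv_mem_lowPoly (i : Fin N) {f : Poly N} (hf : f ∈ lowPoly ν) :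
    X i * pderiv i f ∈ lowPoly ν := by
  intro a ha S
  rw [coeff_X_mul_pderiv] at ha
  exact hf _ (right_ne_zero_of_mul ha) S

theorem dunkl_mem_lowPoly (i : Fin N) {f : Poly N} (hf : f ∈ lowPoly ν) :
    dunkl N β i f ∈ lowPoly ν := by
  rw [dunkl_apply]
  refine add_mem (pderiv_mem_lowPoly i hf) (Submodule.smul_mem _ _ (Submodule.sum_mem _ fun k hk => ?_))
  exact divDiff_mem_lowPoly (Finset.mem_filter.1 hk).2.symm hf

theorem X_mul_dunkl (i : Fin N) (f : Poly N) : X i * dunkl N β i f = X i * pderiv i f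
      + (β : ℂ) • ∑ k ∈ Finset.univ.filter (fun k => k ≠ i), X i * divDiff i k f := by
  rw [dunkl_apply, mul_add, mul_smul_comm, Finset.mul_sum]

theorem X_mul_dunkl_mem_lowPoly (i : Fin N) {f : Poly N} (hf : f ∈ lowPoly ν) :
    X i * dunkl N β i f ∈ lowPoly ν := by
  rw [X_mul_dunkl]
  refine add_mem (X_mul_pderiv_mem_lowPoly i hf) (Submodule.smul_mem _ _ (Submodule.sum_mem _ fun k hk => ?_))
  exact X_mul_divDiff_mem_lowPoly (Finset.mem_filter.1 hk).2.symm hf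

theorem hOp_mem_lowPoly (i : Fin N) {f : Poly N} (hf : f ∈ lowPoly ν) :
    hOp N β i f ∈ lowPoly ν := by
  rw [hOp_apply, numOp_apply, jmOp_apply]
  exact add_mem (sub_mem (X_mul_dunkl_mem_lowPoly i hf)
    (Submodule.smul_mem _ _ (dunkl_mem_lowPoly i (dunkl_mem_lowPoly i hf))))
    (Submodule.smul_mem _ _ (Submodule.sum_mem _ fun k _ => rename_mem_lowPoly _ hf))

theorem hHom_mem_lowPoly (p : Poly N) {f : Poly N} (hf : f ∈ lowPoly ν) :
    hHom N β p f ∈ lowPoly ν := by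
  induction p using MvPolynomial.induction_on with
  | C a => simpa [C_eq_smul_one] using Submodule.smul_mem _ a hf
  | add p q hp hq => rw [map_add]; exact add_mem hp hq
  | mul_X p n hp =>
    rw [mul_comm, map_mul, hHom_X, Module.End.mul_apply]
    exact hOp_mem_lowPoly n hp

/-! ### Diagonal entries of the `h_i` -/

/-- The exponent `ν` written in reverse order. -/
abbrev revExpo (ν : Fin N → ℕ) : Fin N →₀ ℕ := expo (ν ∘ Fin.rev)

theorem sum_Ici_revExpo (ν : Fin N → ℕ) (p : Fin N) :
    ∑ i ∈ Finset.Ici p, revExpo ν i = headSum ν (Finset.Ici p).card := by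
  rw [headSum]
  refine Finset.sum_equiv Fin.revPerm (fun i => ?_) fun i _ => by simp
  simp only [Finset.mem_Ici, Fin.revPerm_apply, Finset.mem_filter, Finset.mem_univ, true_and,
    Fin.card_Ici, Fin.val_rev, Fin.le_def]
  omega

theorem coeff_eq_zero_of_sum_Ici_lt {f : Poly N} (hf : f ∈ lowPoly ν) {a : Fin N →₀ ℕ} (p : Fin N)
    (h : ∑ i ∈ Finset.Ici p, revExpo ν i < ∑ i ∈ Finset.Ici p, a i) : coeff a f = 0 := by
  by_contra ha
  have := hf a ha (Finset.Ici p)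
  rw [sum_Ici_revExpo] at h
  omega

theorem sum_Ici_single_add (p : Fin N) (a : Fin N →₀ ℕ) :
    ∑ i ∈ Finset.Ici p, (Finsupp.single p 1 + a : Fin N →₀ ℕ) i
      = 1 + ∑ i ∈ Finset.Ici p, a i := by
  simp only [Finsupp.add_apply, Finset.sum_add_distrib]
  congr 1
  rw [Finset.sum_eq_single_of_mem p (Finset.mem_Ici.2 le_rfl) fun j _ hj =>
    Finsupp.single_eq_of_ne hj, Finsupp.single_eq_same]

/-- The tail sums of `revExpo ν` attain the bounds defining `lowPoly ν`, so one more unit at `p`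
violates the bound for the tail starting at `p`. -/
theorem coeff_single_add_revExpo (p : Fin N) {f : Poly N} (hf : f ∈ lowPoly ν) :
    coeff (Finsupp.single p 1 + revExpo ν) f = 0 := by
  refine coeff_eq_zero_of_sum_Ici_lt hf p ?_
  rw [sum_Ici_single_add]
  omega

theorem coeff_X_mul_single_add_revExpo {k p : Fin N} (hk : k < p) {f : Poly N}
    (hf : f ∈ lowPoly ν) : coeff (Finsupp.single p 1 + revExpo ν) (X k * f) = 0 := by
  rw [coeff_X_mul']
  split_ifs
  · refine coeff_eq_zero_of_sum_Ici_lt hf p ?_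
    have : ∑ i ∈ Finset.Ici p, (Finsupp.single p 1 + revExpo ν - Finsupp.single k 1 : Fin N →₀ ℕ) i
        = ∑ i ∈ Finset.Ici p, (Finsupp.single p 1 + revExpo ν : Fin N →₀ ℕ) i :=
      Finset.sum_congr rfl fun j hj => by
        have : j ≠ k := (hk.trans_le (Finset.mem_Ici.1 hj)).ne'
        simp [Finsupp.single_eq_of_ne this]
    rw [this, sum_Ici_single_add]
    omega
  · rfl

/-- The leading coefficient of a quotient by `x_i - x_k` is read off one degree higher: since `k <
i`, the product with `x_k` would need an exponent of `u` with too large a tail sum. -/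
theorem coeff_revExpo_of_lt {i k : Fin N} (h : k < i) {u g : Poly N} (hu : u ∈ lowPoly ν)
    (hg : (X i - X k) * u = g) :
    coeff (revExpo ν) u = coeff (Finsupp.single i 1 + revExpo ν) g := by
  rw [← hg, sub_mul, coeff_sub, coeff_X_mul, coeff_X_mul_single_add_revExpo h hu, sub_zero]

theorem coeff_revExpo_of_gt {i k : Fin N} (h : i < k) {u g : Poly N} (hu : u ∈ lowPoly ν)
    (hg : (X i - X k) * u = g) :
    coeff (revExpo ν) u = -coeff (Finsupp.single k 1 + revExpo ν) g := by
  rw [← hg, sub_mul, coeff_sub, coeff_X_mul, coeff_X_mul_single_add_revExpo h hu, zero_sub, neg_neg]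

theorem coeff_revExpo_divDiff {i k : Fin N} (h : i ≠ k) {f : Poly N} (hf : f ∈ lowPoly ν) :
    coeff (revExpo ν) (divDiff i k f) = 0 := by
  rcases lt_or_gt_of_ne h with h' | h'
  · rw [coeff_revExpo_of_gt h' (divDiff_mem_lowPoly h hf) (divDiff_spec h f),
      coeff_single_add_revExpo k (sub_exch_mem_lowPoly i k hf), neg_zero]
  · rw [coeff_revExpo_of_lt h' (divDiff_mem_lowPoly h hf) (divDiff_spec h f),
      coeff_single_add_revExpo i (sub_exch_mem_lowPoly i k hf)]

/-- Reversed exponents are used because of this asymmetry: the exchange terms occur exactly for `k <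
i`, and the sum `∑_{k < i} s_{ik}` in `h_i` cancels them. The remaining `i` copies of the leading
coefficient yield the shift `β i`. -/
theorem coeff_revExpo_X_mul_divDiff {i k : Fin N} (h : i ≠ k) {f : Poly N} (hf : f ∈ lowPoly ν) :
    coeff (revExpo ν) (X i * divDiff i k f)
      = if k < i then coeff (revExpo ν) f - coeff (revExpo ν) (exch i k f) else 0 := by
  have hg : (X i - X k) * (X i * divDiff i k f) = X i * (f - exch i k f) := by
    rw [← divDiff_spec h]; ring
  rcases lt_or_gt_of_ne h with h' | h'
  · rw [coeff_revExpo_of_gt h' (X_mul_divDiff_mem_lowPoly h hf) hg,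
      coeff_X_mul_single_add_revExpo h' (sub_exch_mem_lowPoly i k hf), neg_zero, if_neg h'.not_gt]
  · rw [coeff_revExpo_of_lt h' (X_mul_divDiff_mem_lowPoly h hf) hg, coeff_X_mul, coeff_sub,
      if_pos h']

theorem coeff_revExpo_dunkl (i : Fin N) {f : Poly N} (hf : f ∈ lowPoly ν) :
    coeff (revExpo ν) (dunkl N β i f) = 0 := by
  rw [dunkl_apply, coeff_add, coeff_pderiv_add, add_comm (revExpo ν), coeff_single_add_revExpo i hf,
    coeff_smul, coeff_sum, Finset.sum_eq_zero fun k hk =>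
      coeff_revExpo_divDiff (Finset.mem_filter.1 hk).2.symm hf]
  simp

/-- The operators `h_i` are triangular, with these diagonal entries. -/
theorem coeff_revExpo_hOp (i : Fin N) {f : Poly N} (hf : f ∈ lowPoly ν) :
    coeff (revExpo ν) (hOp N β i f)
      = ((ν (Fin.rev i) : ℂ) + (β : ℂ) * (i : ℕ)) * coeff (revExpo ν) f := by
  have hs : ∑ k ∈ Finset.univ.filter (fun k => k ≠ i), coeff (revExpo ν) (X i * divDiff i k f)
      = (i : ℕ) * coeff (revExpo ν) f
        - ∑ k ∈ Finset.univ.filter (fun k => k < i), coeff (revExpo ν) (exch i k f) := by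
    rw [Finset.sum_congr rfl fun k hk =>
      coeff_revExpo_X_mul_divDiff (Finset.mem_filter.1 hk).2.symm hf, ← Finset.sum_filter,
      Finset.filter_filter]
    have : Finset.univ.filter (fun k => k ≠ i ∧ k < i) = Finset.univ.filter (fun k => k < i) := by
      ext k
      simp only [Finset.mem_filter, Finset.mem_univ, true_and]
      exact ⟨fun h => h.2, fun h => ⟨h.ne, h⟩⟩
    have hcard : (Finset.univ.filter (fun k => k < i)).card = (i : ℕ) := by
      rw [Finset.filter_gt_eq_Iio, Fin.card_Iio]
    rw [this, Finset.sum_sub_distrib, Finset.sum_const, hcard, nsmul_eq_mul]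
  rw [hOp_apply, numOp_apply, jmOp_apply, coeff_add, coeff_sub, X_mul_dunkl, coeff_add,
    coeff_X_mul_pderiv, coeff_smul, coeff_smul, coeff_smul, coeff_sum, coeff_sum, hs,
    coeff_revExpo_dunkl i (dunkl_mem_lowPoly i hf)]
  simp only [smul_eq_mul, Finsupp.equivFunOnFinite_symm_apply_apply, Function.comp]
  ring

theorem coeff_revExpo_hHom (p : Poly N) {f : Poly N} (hf : f ∈ lowPoly ν) :
    coeff (revExpo ν) (hHom N β p f)
      = eval (fun i => (ν (Fin.rev i) : ℂ) + (β : ℂ) * (i : ℕ)) p * coeff (revExpo ν) f := by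
  induction p using MvPolynomial.induction_on with
  | C a => simp [C_eq_smul_one]
  | add p q hp hq => rw [map_add, LinearMap.add_apply, coeff_add, hp, hq, map_add, add_mul]
  | mul_X p n hp =>
    rw [mul_comm, map_mul, hHom_X, Module.End.mul_apply,
      coeff_revExpo_hOp n (hHom_mem_lowPoly p hf), hp, map_mul, eval_X, mul_assoc]

/-! ### Leading coefficients of products -/

theorem eq_of_sum_Ici_eq {a b : Fin N →₀ ℕ}
    (h : ∀ p, ∑ i ∈ Finset.Ici p, a i = ∑ i ∈ Finset.Ici p, b i) : a = b := by
  ext p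
  induction p using WellFoundedGT.induction with
  | ind p ih =>
    have hI : Finset.Ici p = insert p (Finset.Ioi p) := by
      ext j; simp [le_iff_eq_or_lt]
    have := h p
    rw [hI, Finset.sum_insert (by simp), Finset.sum_insert (by simp),
      Finset.sum_congr rfl fun j hj => ih j (Finset.mem_Ioi.1 hj)] at this
    exact Nat.add_right_cancel this

/-- All exponents of `f` have tail sums at most those of `a`. -/
def IsUnder (a : Fin N →₀ ℕ) (f : Poly N) : Prop :=
  ∀ b, coeff b f ≠ 0 → ∀ p, ∑ i ∈ Finset.Ici p, b i ≤ ∑ i ∈ Finset.Ici p, a i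

theorem isUnder_revExpo {f : Poly N} (hf : f ∈ lowPoly ν) : IsUnder (revExpo ν) f := by
  intro b hb p
  rw [sum_Ici_revExpo]
  exact hf b hb _

/-- If `c + d = a + b` and the tail sums of `c`, `d` are bounded by those of `a`, `b`, then all of
them are equal, and tail sums determine an exponent. Hence leading terms multiply. -/
theorem IsUnder.coeff_mul_add {a b : Fin N →₀ ℕ} {f g : Poly N} (hf : IsUnder a f)
    (hg : IsUnder b g) : coeff (a + b) (f * g) = coeff a f * coeff b g := by
  rw [coeff_mul]
  refine Finset.sum_eq_single_of_mem (a, b) (by simp) ?_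
  rintro ⟨c, d⟩ hcd hne
  replace hcd := Finset.HasAntidiagonal.mem_antidiagonal.1 hcd
  by_contra h0
  have hc := hf c (left_ne_zero_of_mul h0)
  have hd := hg d (right_ne_zero_of_mul h0)
  have hs : ∀ p, ∑ i ∈ Finset.Ici p, c i + ∑ i ∈ Finset.Ici p, d i
      = ∑ i ∈ Finset.Ici p, a i + ∑ i ∈ Finset.Ici p, b i := by
    intro p
    rw [← Finset.sum_add_distrib, ← Finset.sum_add_distrib]
    exact Finset.sum_congr rfl fun i _ => DFunLike.congr_fun hcd i
  refine hne (Prod.ext (eq_of_sum_Ici_eq fun p => ?_) (eq_of_sum_Ici_eq fun p => ?_)) <;>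
  · have := hc p
    have := hd p
    have := hs p
    simp only at *
    omega

theorem IsUnder.mul {a b : Fin N →₀ ℕ} {f g : Poly N} (hf : IsUnder a f) (hg : IsUnder b g) :
    IsUnder (a + b) (f * g) := by
  intro c hc p
  rw [coeff_mul] at hc
  obtain ⟨⟨d, e⟩, hde, h0⟩ := Finset.exists_ne_zero_of_sum_ne_zero hc
  replace hde := Finset.HasAntidiagonal.mem_antidiagonal.1 hde
  have hd := hf d (left_ne_zero_of_mul h0) p
  have he := hg e (right_ne_zero_of_mul h0) p
  simp only at hde hd he
  subst hde
  simp only [Finsupp.add_apply, Finset.sum_add_distrib]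
  omega

theorem IsUnder.prod {ι : Type*} (s : Finset ι) {a : ι → Fin N →₀ ℕ} {f : ι → Poly N}
    (h : ∀ i ∈ s, IsUnder (a i) (f i)) :
    IsUnder (∑ i ∈ s, a i) (∏ i ∈ s, f i)
      ∧ coeff (∑ i ∈ s, a i) (∏ i ∈ s, f i) = ∏ i ∈ s, coeff (a i) (f i) := by
  classical
  induction s using Finset.induction_on with
  | empty =>
    refine ⟨fun b hb p => ?_, by simp⟩
    rw [Finset.prod_empty, coeff_one] at hb
    have : 0 = b := by by_contra h; exact hb (if_neg h)
    simp [← this]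
  | insert i s hi ih =>
    obtain ⟨h1, h2⟩ := ih fun j hj => h j (Finset.mem_insert_of_mem hj)
    have hi' := h i (Finset.mem_insert_self i s)
    rw [Finset.sum_insert hi, Finset.prod_insert hi, Finset.prod_insert hi, ← h2]
    exact ⟨hi'.mul h1, hi'.coeff_mul_add h1⟩

/-- For tail sums the later variable dominates, so the leading term is `-x_j`; this produces the
signs in `coeff_vand`. -/
theorem isUnder_X_sub_X {i j : Fin N} (h : i < j) :
    IsUnder (Finsupp.single j 1) (X i - X j : Poly N) := by
  intro b hb p
  have hs : ∀ k : Fin N, ∑ l ∈ Finset.Ici p, Finsupp.single k 1 l = if p ≤ k then 1 else 0 := by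
    intro k
    simp [Finsupp.single_apply]
  rw [coeff_sub, coeff_X, coeff_X] at hb
  by_cases hi : Finsupp.single i 1 = b
  · subst hi
    rw [hs, hs]
    split_ifs with h1 h2
    · exact le_rfl
    · exact absurd (h1.trans h.le) h2
    · exact zero_le
    · exact le_rfl
  · by_cases hj : Finsupp.single j 1 = b
    · subst hj; exact le_rfl
    · simp [hi, hj] at hb

theorem revExpo_stair (N : ℕ) : revExpo (stair N)
    = ∑ i : Fin N, ∑ j ∈ Finset.univ.filter (fun j => i < j), Finsupp.single j 1 := by
  ext k
  simp only [Finsupp.finsetSum_apply, Finset.sum_filter]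
  rw [Finset.sum_congr rfl fun i _ => show
    ∑ j : Fin N, (if i < j then Finsupp.single j 1 else 0 : Fin N →₀ ℕ) k = if i < k then 1 else 0
      from ?_]
  · rw [← Finset.sum_filter, Finset.sum_const, Finset.filter_gt_eq_Iio, Fin.card_Iio]
    simp [stair]
  · rw [Finset.sum_eq_single_of_mem k (Finset.mem_univ k)]
    · split_ifs <;> simp
    · intro j _ hj
      split_ifs <;> simp [Finsupp.single_eq_of_ne hj.symm]

theorem isUnder_vand_aux (N : ℕ) : IsUnder (revExpo (stair N)) (vand N)
    ∧ coeff (revExpo (stair N)) (vand N)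
      = ∏ i : Fin N, ∏ _j ∈ Finset.univ.filter (fun j => i < j), (-1 : ℂ) := by
  have h : ∀ i ∈ Finset.univ, _ := fun (i : Fin N) (_ : i ∈ Finset.univ) =>
    IsUnder.prod (Finset.univ.filter (fun j => i < j)) (a := fun j : Fin N => Finsupp.single j 1)
      (f := fun j => (X i - X j : Poly N))
      fun j hj => isUnder_X_sub_X (Finset.mem_filter.1 hj).2
  have := IsUnder.prod Finset.univ fun i hi => (h i hi).1
  rw [revExpo_stair, vand]
  refine ⟨this.1, this.2.trans (Finset.prod_congr rfl fun i hi => ?_)⟩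
  rw [(h i hi).2]
  refine Finset.prod_congr rfl fun j hj => ?_
  rw [coeff_sub, coeff_X, coeff_X, if_pos rfl, if_neg, zero_sub]
  exact fun e => (Finset.mem_filter.1 hj).2.ne (Finsupp.single_left_injective one_ne_zero e)

theorem isUnder_vand (N : ℕ) : IsUnder (revExpo (stair N)) (vand N) := (isUnder_vand_aux N).1

theorem coeff_vand (N : ℕ) : coeff (revExpo (stair N)) (vand N)
      = ∏ i : Fin N, ∏ _j ∈ Finset.univ.filter (fun j => i < j), (-1 : ℂ) := (isUnder_vand_aux N).2

theorem coeff_vand_ne_zero (N : ℕ) : coeff (revExpo (stair N)) (vand N) ≠ 0 := by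
  rw [coeff_vand]
  exact Finset.prod_ne_zero_iff.2 fun _ _ => Finset.prod_ne_zero_iff.2 fun _ _ => by simp

theorem exists_perm_map_Ici (S : Finset (Fin N)) (hS : S.Nonempty) :
    ∃ (w : Equiv.Perm (Fin N)) (p : Fin N), S = (Finset.Ici p).map w.toEmbedding := by
  have h1 : 1 ≤ S.card := hS.card_pos
  have h2 : S.card ≤ N := by simpa using Finset.card_le_univ S
  let p : Fin N := ⟨N - S.card, by omega⟩
  have hcard : Fintype.card {i // i ∈ Finset.Ici p} = Fintype.card {i // i ∈ S} := by
    rw [Fintype.card_coe, Fintype.card_coe, Fin.card_Ici]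
    simp only [p]
    omega
  let e := Fintype.equivOfCardEq hcard
  refine ⟨e.extendSubtype, p, ?_⟩
  symm
  refine Finset.eq_of_subset_of_card_le ?_ ?_
  · intro x hx
    obtain ⟨y, hy, rfl⟩ := Finset.mem_map.1 hx
    exact Equiv.extendSubtype_mem e y hy
  · rw [Finset.card_map]
    rw [Fintype.card_coe, Fintype.card_coe] at hcard
    exact hcard.ge

/-- For a polynomial with permutation invariant support, tail sums suffice. -/
theorem mem_lowPoly_of_isUnder {f : Poly N} (hf : IsUnder (revExpo ν) f)
    (hs : ∀ (w : Equiv.Perm (Fin N)) a, coeff a f ≠ 0 → coeff (expo (a ∘ w)) f ≠ 0) :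
    f ∈ lowPoly ν := by
  intro a ha S
  rcases S.eq_empty_or_nonempty with rfl | hS
  · simp
  obtain ⟨w, p, rfl⟩ := exists_perm_map_Ici S hS
  have := hf _ (hs w a ha) p
  rw [sum_Ici_revExpo] at this
  rw [Finset.card_map, Finset.sum_map]
  exact this

theorem IsSym.coeff_perm {f : Poly N} (hf : IsSym f) (w : Equiv.Perm (Fin N)) (a : Fin N →₀ ℕ) :
    coeff (expo (a ∘ w)) f = coeff a f := by
  rw [← coeff_rename_perm, hf w]

theorem IsAlt.coeff_perm {f : Poly N} (hf : IsAlt f) (w : Equiv.Perm (Fin N)) (a : Fin N →₀ ℕ) :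
    coeff (expo (a ∘ w)) f = ((Equiv.Perm.sign w : ℤ) : ℂ) * coeff a f := by
  rw [← coeff_rename_perm, hf w, coeff_smul, smul_eq_mul]

theorem IsSym.mem_lowPoly {f : Poly N} (hs : IsSym f) (hf : IsUnder (revExpo ν) f) :
    f ∈ lowPoly ν :=
  mem_lowPoly_of_isUnder hf fun w a ha => by rwa [hs.coeff_perm]

theorem IsAlt.mem_lowPoly {f : Poly N} (hs : IsAlt f) (hf : IsUnder (revExpo ν) f) :
    f ∈ lowPoly ν :=
  mem_lowPoly_of_isUnder hf fun w a ha => by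
    rw [hs.coeff_perm]
    exact mul_ne_zero (by simp) ha

theorem revExpo_add (μ ν : Fin N → ℕ) : revExpo (μ + ν) = revExpo μ + revExpo ν := by
  ext i; simp

theorem isAlt_vand_mul {f : Poly N} (hf : IsSym f) : IsAlt (vand N * f) := by
  intro w
  rw [map_mul, isAlt_vand N w, hf w, smul_mul_assoc]

theorem isSym_of_vand_mul {f : Poly N} (hf : IsAlt (vand N * f)) : IsSym f := by
  intro w
  have := hf w
  rw [map_mul, isAlt_vand N w, smul_mul_assoc] at this
  have h0 : ((Equiv.Perm.sign w : ℤ) : ℂ) ≠ 0 := by simp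
  exact mul_left_cancel₀ (vand_ne_zero N) (smul_right_injective _ h0 this)

theorem vand_mul_mem_lowPoly {f : Poly N} (hs : IsSym f) (hf : f ∈ lowPoly ν) :
    vand N * f ∈ lowPoly (ν + stair N) := by
  refine (isAlt_vand_mul hs).mem_lowPoly ?_
  rw [revExpo_add, add_comm]
  exact (isUnder_vand N).mul (isUnder_revExpo hf)

theorem coeff_vand_mul {f : Poly N} (hf : f ∈ lowPoly ν) :
    coeff (revExpo (ν + stair N)) (vand N * f)
      = coeff (revExpo (stair N)) (vand N) * coeff (revExpo ν) f := by
  rw [revExpo_add, add_comm]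
  exact (isUnder_vand N).coeff_mul_add (isUnder_revExpo hf)

/-- Tail degrees add, and the Vandermonde product has tail degrees at least those of the staircase,
so they can be subtracted. Symmetry reduces arbitrary subsets to tails. -/
theorem mem_lowPoly_of_vand_mul {f : Poly N} (hs : IsSym f)
    (hf : vand N * f ∈ lowPoly (ν + stair N)) : f ∈ lowPoly ν := by
  rcases eq_or_ne f 0 with rfl | h0
  · exact zero_mem _
  refine hs.mem_lowPoly fun b hb p => ?_
  have h1 := mem_lowPoly_iff_partialDeg.1 hf (Finset.Ici p)
  rw [partialDeg_mul _ (vand_ne_zero N) h0, ← sum_Ici_revExpo, revExpo_add] at h1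
  simp only [Finsupp.add_apply, Finset.sum_add_distrib] at h1
  have h2 := sum_le_partialDeg (Finset.Ici p) (coeff_vand_ne_zero N)
  have h3 := sum_le_partialDeg (Finset.Ici p) hb
  omega

/-! ### Divisibility of skew-symmetric polynomials by the Vandermonde product -/

theorem irreducible_X_sub_X {i j : Fin N} (h : i ≠ j) : Irreducible (X i - X j : Poly N) := by
  have hc : coeff (Finsupp.single i 1) (X i - X j : Poly N) = 1 := by
    rw [coeff_sub, coeff_X, coeff_X, if_pos rfl,
      if_neg fun e => h (Finsupp.single_left_injective one_ne_zero e).symm, sub_zero]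
  refine irreducible_of_totalDegree_eq_one (le_antisymm ?_ ?_) fun x hx => ?_
  · refine (totalDegree_sub _ _).trans ?_
    simp
  · have := le_totalDegree (p := (X i - X j : Poly N)) (s := Finsupp.single i 1)
      (by rw [mem_support_iff, hc]; exact one_ne_zero)
    simpa using this
  · have := hx (Finsupp.single i 1)
    rw [hc] at this
    exact isUnit_of_dvd_one this

theorem isRelPrime_X_sub_X {i j k l : Fin N} (hij : i < j) (hkl : k < l) (hne : (i, j) ≠ (k, l)) :
    IsRelPrime (X i - X j : Poly N) (X k - X l) := by
  refine (irreducible_X_sub_X hij.ne).isRelPrime_iff_not_dvd.2 ?_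
  rintro ⟨q, hq⟩
  -- A point where `x_i = x_j = 0` while the other coordinates are distinct and nonzero: `x_i - x_j`
  -- vanishes there, but `x_k - x_l` does not.
  have h := congrArg (eval fun m : Fin N => if m = i ∨ m = j then (0 : ℂ) else (m : ℕ) + 1) hq
  simp only [map_sub, eval_X, map_mul, true_or, or_true, if_true, sub_self, zero_mul,
    sub_eq_zero] at h
  rw [Ne, Prod.mk.injEq] at hne
  split_ifs at h with h1 h2 h2
  · simp only [Fin.lt_def, Fin.ext_iff] at *
    omega
  · exact Nat.cast_add_one_ne_zero (R := ℂ) _ h.symm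
  · exact Nat.cast_add_one_ne_zero (R := ℂ) _ h
  · have h3 : (k : ℕ) = l := by exact_mod_cast add_right_cancel h
    exact hkl.ne (Fin.ext h3)

theorem exists_vand_mul {f : Poly N} (hf : IsAlt f) : ∃ g, IsSym g ∧ f = vand N * g := by
  have hd : vand N ∣ f := by
    rw [vand_eq_prod]
    refine Finset.prod_dvd_of_isRelPrime ?_ ?_
    · rintro ⟨i, j⟩ h1 ⟨k, l⟩ h2 hne
      simp only [Finset.coe_filter, Finset.mem_univ, true_and, Set.mem_ofPred_eq] at h1 h2
      exact isRelPrime_X_sub_X h1 h2 hne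
    · intro p hp
      exact X_sub_X_dvd_of_isAlt hf (Finset.mem_filter.1 hp).2.ne
  obtain ⟨g, rfl⟩ := hd
  exact ⟨g, isSym_of_vand_mul hf, rfl⟩

/-! ### Monomial symmetric polynomials -/

theorem headSum_succ (ν : Fin N → ℕ) (k : Fin N) : headSum ν (k + 1) = ∑ i ∈ Finset.Iic k, ν i := by
  rw [headSum]
  congr 1
  ext i
  simp only [Finset.mem_filter, Finset.mem_univ, true_and, Finset.mem_Iic, Fin.le_def]
  omega

theorem headSum_zero (ν : Fin N → ℕ) : headSum ν 0 = 0 := by simp [headSum]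

theorem headSum_le_headSum {μ ν : Fin N → ℕ}
    (h : ∀ k : Fin N, ∑ i ∈ Finset.Iic k, μ i ≤ ∑ i ∈ Finset.Iic k, ν i) {k : ℕ} (hk : k ≤ N) :
    headSum μ k ≤ headSum ν k := by
  rcases k with _ | k
  · rw [headSum_zero, headSum_zero]
  · have := h ⟨k, hk⟩
    rwa [← headSum_succ, ← headSum_succ] at this

theorem lowPoly_mono {μ ν : Fin N → ℕ}
    (h : ∀ k : Fin N, ∑ i ∈ Finset.Iic k, μ i ≤ ∑ i ∈ Finset.Iic k, ν i) :
    lowPoly μ ≤ lowPoly ν := fun _ hf a ha S =>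
  (hf a ha S).trans (headSum_le_headSum h (by simpa using Finset.card_le_univ S))

theorem sum_le_headSum {μ : Fin N → ℕ} (hμ : Antitone μ) (S : Finset (Fin N)) :
    ∑ i ∈ S, μ i ≤ headSum μ S.card := by
  set T := Finset.univ.filter (fun i : Fin N => (i : ℕ) < S.card) with hT
  have hN : S.card ≤ N := by simpa using Finset.card_le_univ S
  have hTc : T.card = S.card := by rw [hT, Fin.card_filter_val_lt, min_eq_right hN]
  have hd : (S \ T).card = (T \ S).card := Finset.card_sdiff_comm hTc.symm
  rw [headSum, ← hT, ← Finset.sum_inter_add_sum_sdiff S T, ← Finset.sum_inter_add_sum_sdiff T S,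
    Finset.inter_comm T S]
  refine Nat.add_le_add_left ?_ _
  rcases (S \ T).eq_empty_or_nonempty with he | ⟨x, hx⟩
  · rw [he]; simp
  have hk : S.card < N := by
    simp only [hT, Finset.mem_sdiff, Finset.mem_filter, Finset.mem_univ, true_and] at hx
    omega
  calc ∑ i ∈ S \ T, μ i ≤ (S \ T).card • μ ⟨S.card, hk⟩ := by
        refine Finset.sum_le_card_nsmul _ _ _ fun i hi => hμ ?_
        simp only [hT, Finset.mem_sdiff, Finset.mem_filter, Finset.mem_univ, true_and] at hi
        rw [Fin.le_def]
        simp only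
        omega
    _ = (T \ S).card • μ ⟨S.card, hk⟩ := by rw [hd]
    _ ≤ ∑ i ∈ T \ S, μ i := by
        refine Finset.card_nsmul_le_sum _ _ _ fun i hi => hμ ?_
        simp only [hT, Finset.mem_sdiff, Finset.mem_filter, Finset.mem_univ, true_and] at hi
        rw [Fin.le_def]
        simp only
        omega

theorem coeff_msym (μ : Fin N → ℕ) (a : Fin N →₀ ℕ) [Decidable (∃ w : Equiv.Perm (Fin N), μ ∘ w = a)] :
    coeff a (msym μ) = if ∃ w : Equiv.Perm (Fin N), μ ∘ w = a then 1 else 0 := by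
  rw [msym, coeff_sum]
  simp only [coeff_monomial]
  have h : ∀ b : Fin N → ℕ, expo b = a ↔ b = a := fun b =>
    ⟨fun h => by rw [← h]; rfl, fun h => by rw [h]; exact Finsupp.equivFunOnFinite_symm_coe a⟩
  simp only [h]
  rw [Finset.sum_ite_eq']
  simp

theorem isSym_msym (μ : Fin N → ℕ) : IsSym (msym μ) := by
  classical
  intro w
  ext a
  rw [coeff_rename_perm, coeff_msym, coeff_msym]
  congr 1
  refine propext ⟨fun ⟨v, hv⟩ => ⟨v * w⁻¹, ?_⟩, fun ⟨v, hv⟩ => ⟨v * w, ?_⟩⟩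
  · ext i
    have := congrFun hv (w⁻¹ i)
    simpa using this
  · ext i
    have := congrFun hv (w i)
    simpa using this

theorem msym_mem_lowPoly {μ : Fin N → ℕ} (hμ : Antitone μ) : msym μ ∈ lowPoly μ := by
  classical
  intro a ha S
  rw [coeff_msym] at ha
  have h : ∃ w : Equiv.Perm (Fin N), μ ∘ w = a := by by_contra h; exact ha (if_neg h)
  obtain ⟨w, hw⟩ := h
  have := sum_le_headSum hμ (S.map w.toEmbedding)
  rw [Finset.card_map, Finset.sum_map] at this
  rw [← hw]
  exact this

theorem coeff_revExpo_msym (μ : Fin N → ℕ) : coeff (revExpo μ) (msym μ) = 1 := by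
  classical
  rw [coeff_msym, if_pos]
  exact ⟨Fin.revPerm, rfl⟩

theorem exists_antitone_perm (a : Fin N → ℕ) : ∃ w : Equiv.Perm (Fin N), Antitone (a ∘ w) :=
  ⟨Tuple.sort (OrderDual.toDual ∘ a), fun _ _ h => Tuple.monotone_sort (OrderDual.toDual ∘ a) h⟩

theorem antitone_perm_unique {a : Fin N → ℕ} {v w : Equiv.Perm (Fin N)} (hv : Antitone (a ∘ v))
    (hw : Antitone (a ∘ w)) : a ∘ v = a ∘ w :=
  Tuple.unique_monotone (α := ℕᵒᵈ) (f := OrderDual.toDual ∘ a) (fun _ _ h => hv h)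
    (fun _ _ h => hw h)

theorem IsSym.mem_span {f : Poly N} (hf : IsSym f) :
    f ∈ Submodule.span ℂ {p | ∃ μ : Fin N → ℕ, Antitone μ ∧ coeff (expo μ) f ≠ 0 ∧ p = msym μ} := by
  classical
  -- Every orbit of exponents has exactly one antitone representative, and a symmetric polynomial
  -- has constant coefficients on orbits.
  have key : f = ∑ a ∈ f.support.filter (fun a : Fin N →₀ ℕ => Antitone (a : Fin N → ℕ)),
      coeff a f • msym (a : Fin N → ℕ) := by
    ext b
    obtain ⟨w, hw⟩ := exists_antitone_perm (b : Fin N → ℕ)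
    have hbw : coeff (expo (b ∘ w)) f = coeff b f := hf.coeff_perm w b
    rw [coeff_sum]
    simp only [coeff_smul, coeff_msym, smul_eq_mul, mul_ite, mul_one, mul_zero]
    have huniq : ∀ a : Fin N →₀ ℕ, Antitone (a : Fin N → ℕ) →
        (∃ v : Equiv.Perm (Fin N), a ∘ v = b) → a = expo (b ∘ w) := by
      rintro a ha ⟨v, hv⟩
      have hb : Antitone (b ∘ (v⁻¹ : Equiv.Perm (Fin N))) := by
        rw [← hv]
        convert ha
        ext i
        simp
      have := antitone_perm_unique hw hb
      ext i
      change a i = b (w i)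
      rw [show b (w i) = b (v⁻¹ i) from congrFun this i, ← congrFun hv]
      simp
    by_cases h0 : coeff b f = 0
    · rw [h0]
      symm
      refine Finset.sum_eq_zero fun a ha => ?_
      split_ifs with h
      · rw [huniq a (Finset.mem_filter.1 ha).2 h, hbw, h0]
      · rfl
    · rw [Finset.sum_eq_single_of_mem (expo (b ∘ w)), if_pos, hbw]
      · exact ⟨w⁻¹, by ext i; simp⟩
      · rw [Finset.mem_filter, mem_support_iff, hbw]
        exact ⟨h0, hw⟩
      · intro a ha hne
        rw [if_neg]
        exact fun h => hne (huniq a (Finset.mem_filter.1 ha).2 h)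
  rw [key]
  refine Submodule.sum_mem _ fun a ha => Submodule.smul_mem _ _ (Submodule.subset_span ?_)
  rw [Finset.mem_filter, mem_support_iff] at ha
  refine ⟨a, ha.2, ?_, rfl⟩
  rw [← key]
  rw [show expo (a : Fin N → ℕ) = a from Finsupp.equivFunOnFinite_symm_coe a]
  exact ha.1

theorem eq_of_sum_Iic_eq {a b : Fin N → ℕ}
    (h : ∀ p, ∑ i ∈ Finset.Iic p, a i = ∑ i ∈ Finset.Iic p, b i) : a = b := by
  ext p
  induction p using WellFoundedLT.induction with
  | ind p ih =>
    have hI : Finset.Iic p = insert p (Finset.Iio p) := by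
      ext j; simp [le_iff_eq_or_lt]
    have := h p
    rw [hI, Finset.sum_insert (by simp), Finset.sum_insert (by simp),
      Finset.sum_congr rfl fun j hj => ih j (Finset.mem_Iio.1 hj)] at this
    exact Nat.add_right_cancel this

/-- The span of the `m_μ` with `μ` strictly below `l`. -/
abbrev lowerSpan (l : Fin N → ℕ) : Submodule ℂ (Poly N) :=
  Submodule.span ℂ {p | ∃ μ : Fin N → ℕ, Antitone μ ∧ DomLT μ l ∧ p = msym μ}

theorem sum_Iic_le_of_coeff_ne_zero {f : Poly N} (hf : f ∈ lowPoly ν) {a : Fin N → ℕ}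
    (ha : coeff (expo a) f ≠ 0) (k : Fin N) :
    ∑ i ∈ Finset.Iic k, a i ≤ ∑ i ∈ Finset.Iic k, ν i := by
  have := hf _ ha (Finset.Iic k)
  rwa [Fin.card_Iic, headSum_succ] at this

theorem coeff_revExpo_eq_zero_of_domLT {l : Fin N → ℕ} (h : DomLT ν l) {f : Poly N}
    (hf : f ∈ lowPoly ν) : coeff (revExpo l) f = 0 := by
  by_contra h0
  refine h.2 (eq_of_sum_Iic_eq fun k => le_antisymm (h.1 k) ?_)
  refine sum_Iic_le_of_coeff_ne_zero (f := rename Fin.revPerm f) (rename_mem_lowPoly _ hf) ?_ k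
  rw [coeff_rename_perm]
  exact h0

/-- The bridge from degree bounds back to the dominance order: a symmetric polynomial within the
bounds involves only partitions dominated by `ν`, and `ν` itself is excluded by the vanishing
coefficient. -/
theorem IsSym.mem_lowerSpan {f : Poly N} (hs : IsSym f) (hf : f ∈ lowPoly ν)
    (h0 : coeff (revExpo ν) f = 0) : f ∈ lowerSpan ν := by
  refine Submodule.span_mono ?_ hs.mem_span
  rintro _ ⟨μ, hμ, hc, rfl⟩
  refine ⟨μ, hμ, ⟨sum_Iic_le_of_coeff_ne_zero hf hc, ?_⟩, rfl⟩
  rintro rfl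
  refine hc ?_
  rw [← h0]
  exact (hs.coeff_perm Fin.revPerm (expo μ)).symm

theorem IsSym.mem_lowerSpan_of_domLT {l : Fin N → ℕ} (h : DomLT ν l) {f : Poly N} (hs : IsSym f)
    (hf : f ∈ lowPoly ν) : f ∈ lowerSpan l :=
  hs.mem_lowerSpan (lowPoly_mono h.1 hf) (coeff_revExpo_eq_zero_of_domLT h hf)

theorem IsSym.add {f g : Poly N} (hf : IsSym f) (hg : IsSym g) : IsSym (f + g) := fun w => by
  rw [map_add, hf w, hg w]

theorem IsSym.smul {f : Poly N} (c : ℂ) (hf : IsSym f) : IsSym (c • f) := fun w => by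
  rw [map_smul, hf w]

theorem IsSym.sub {f g : Poly N} (hf : IsSym f) (hg : IsSym g) : IsSym (f - g) := fun w => by
  rw [map_sub, hf w, hg w]

theorem isSym_of_mem_lowerSpan {l : Fin N → ℕ} {f : Poly N} (hf : f ∈ lowerSpan l) : IsSym f := by
  induction hf using Submodule.span_induction with
  | mem x hx => obtain ⟨μ, _, _, rfl⟩ := hx; exact isSym_msym μ
  | zero => exact fun w => map_zero _
  | add x y _ _ hx hy => exact hx.add hy
  | smul c x _ hx => exact hx.smul c

theorem mem_lowPoly_of_mem_lowerSpan {l : Fin N → ℕ} {f : Poly N} (hf : f ∈ lowerSpan l) :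
    f ∈ lowPoly l ∧ coeff (revExpo l) f = 0 := by
  induction hf using Submodule.span_induction with
  | mem x hx =>
    obtain ⟨μ, hμ, hd, rfl⟩ := hx
    exact ⟨lowPoly_mono hd.1 (msym_mem_lowPoly hμ),
      coeff_revExpo_eq_zero_of_domLT hd (msym_mem_lowPoly hμ)⟩
  | zero => exact ⟨zero_mem _, coeff_zero _⟩
  | add x y _ _ hx hy => exact ⟨add_mem hx.1 hy.1, by rw [coeff_add, hx.2, hy.2, add_zero]⟩
  | smul c x _ hx => exact ⟨Submodule.smul_mem _ _ hx.1, by rw [coeff_smul, hx.2, smul_zero]⟩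

/-! ### Existence and uniqueness of the Hermite polynomials -/

theorem scal_eq_zero_of_mem_lowerSpan {l : Fin N → ℕ} {P f : Poly N}
    (hP : ∀ μ : Fin N → ℕ, Antitone μ → DomLT μ l → scal N β P (msym μ) = 0)
    (hf : f ∈ lowerSpan l) : scalForm N β P f = 0 := by
  induction hf using Submodule.span_induction with
  | mem x hx => obtain ⟨μ, hμ, hd, rfl⟩ := hx; exact hP μ hμ hd
  | zero => exact map_zero _
  | add x y _ _ hx hy => rw [map_add, hx, hy, add_zero]
  | smul c x _ hx => rw [map_smul, hx, smul_zero]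

/-- The `m_μ` have real coefficients. This allows positivity to be used within the span. -/
theorem map_conj_mem_lowerSpan {l : Fin N → ℕ} {f : Poly N} (hf : f ∈ lowerSpan l) :
    map (starRingEnd ℂ) f ∈ lowerSpan l := by
  induction hf using Submodule.span_induction with
  | mem x hx =>
    refine Submodule.subset_span ?_
    obtain ⟨μ, hμ, hd, rfl⟩ := hx
    refine ⟨μ, hμ, hd, ?_⟩
    simp [msym, map_monomial]
  | zero => simp
  | add x y _ _ hx hy => rw [map_add]; exact add_mem hx hy
  | smul c x _ hx =>
    rw [smul_eq_C_mul, map_mul, map_C, ← smul_eq_C_mul]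
    exact Submodule.smul_mem _ _ hx

theorem eq_zero_of_mem_lowerSpan {l : Fin N → ℕ} {f : Poly N} (hf : f ∈ lowerSpan l)
    (h : ∀ μ : Fin N → ℕ, Antitone μ → DomLT μ l → scal N β f (msym μ) = 0) : f = 0 :=
  eq_zero_of_scal_conj_self (scal_eq_zero_of_mem_lowerSpan h (map_conj_mem_lowerSpan hf))

theorem finite_domLT (l : Fin N → ℕ) : {μ : Fin N → ℕ | DomLT μ l}.Finite := by
  refine (Set.finite_Iic (fun _ : Fin N => ∑ i, l i)).subset fun μ hμ k => ?_
  calc μ k ≤ ∑ i ∈ Finset.Iic k, μ i :=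
        Finset.single_le_sum (f := μ) (fun _ _ => Nat.zero_le _) (Finset.mem_Iic.2 le_rfl)
    _ ≤ ∑ i ∈ Finset.Iic k, l i := hμ.1 k
    _ ≤ ∑ i, l i := Finset.sum_le_sum_of_subset (Finset.subset_univ _)

theorem finiteDimensional_lowerSpan (l : Fin N → ℕ) : FiniteDimensional ℂ (lowerSpan l) := by
  refine FiniteDimensional.span_of_finite ℂ (((finite_domLT l).image msym).subset ?_)
  rintro _ ⟨μ, _, hd, rfl⟩
  exact ⟨μ, hd, rfl⟩

/-- Orthogonal projection: the form is nondegenerate on the finite-dimensional span, so every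
functional on the span is represented by an element of it. -/
theorem exists_lowerSpan_scal_eq (β : ℕ) (l : Fin N → ℕ) (f : Poly N) :
    ∃ g ∈ lowerSpan l, ∀ μ : Fin N → ℕ, Antitone μ → DomLT μ l →
      scal N β g (msym μ) = scal N β f (msym μ) := by
  have := finiteDimensional_lowerSpan l
  let T : lowerSpan l →ₗ[ℂ] Module.Dual ℂ (lowerSpan l) :=
    (scalForm N β).compl₁₂ (lowerSpan l).subtype (lowerSpan l).subtype
  have hinj : Function.Injective T := by
    refine (injective_iff_map_eq_zero T).2 fun g hg => ?_
    refine Subtype.ext (eq_zero_of_mem_lowerSpan (β := β) g.2 fun μ hμ hd => ?_)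
    exact LinearMap.congr_fun hg ⟨msym μ, Submodule.subset_span ⟨μ, hμ, hd, rfl⟩⟩
  have hsurj : Function.Surjective T :=
    (LinearMap.injective_iff_surjective_of_finrank_eq_finrank
      Subspace.dual_finrank_eq.symm).1 hinj
  obtain ⟨g, hg⟩ := hsurj ((scalForm N β f).comp (lowerSpan l).subtype)
  refine ⟨g, g.2, fun μ hμ hd => ?_⟩
  exact LinearMap.congr_fun hg ⟨msym μ, Submodule.subset_span ⟨μ, hμ, hd, rfl⟩⟩

/-- A multiple of the Hermite polynomial is determined by its leading coefficient. -/
theorem IsHermite.eq_smul {l : Fin N → ℕ} {P R : Poly N} {c : ℂ} (hP : IsHermite N β l P)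
    (hR : R - c • msym l ∈ lowerSpan l)
    (h : ∀ μ : Fin N → ℕ, Antitone μ → DomLT μ l → scal N β R (msym μ) = 0) : R = c • P := by
  refine sub_eq_zero.1 (eq_zero_of_mem_lowerSpan (β := β) (l := l) ?_ fun μ hμ hd => ?_)
  · have : R - c • P = (R - c • msym l) - c • (P - msym l) := by rw [smul_sub]; abel
    rw [this]
    exact sub_mem hR (Submodule.smul_mem _ _ hP.1)
  · rw [← scalForm_apply, map_sub, map_smul, LinearMap.sub_apply, LinearMap.smul_apply,
      scalForm_apply, scalForm_apply, h μ hμ hd, hP.2 μ hμ hd, smul_zero, sub_zero]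

theorem existsUnique_isHermite (β : ℕ) (l : Fin N → ℕ) : ∃! P, IsHermite N β l P := by
  obtain ⟨g, hg, hs⟩ := exists_lowerSpan_scal_eq β l (msym l)
  refine ⟨msym l - g, ⟨?_, fun μ hμ hd => ?_⟩, fun Q hQ => ?_⟩
  · rw [sub_sub_cancel_left]
    exact neg_mem hg
  · rw [← scalForm_apply, map_sub, LinearMap.sub_apply, scalForm_apply, scalForm_apply,
      hs μ hμ hd, sub_self]
  · have hP : IsHermite N β l (msym l - g) := by
      refine ⟨?_, fun μ hμ hd => ?_⟩
      · rw [sub_sub_cancel_left]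
        exact neg_mem hg
      · rw [← scalForm_apply, map_sub, LinearMap.sub_apply, scalForm_apply, scalForm_apply,
          hs μ hμ hd, sub_self]
    have := hP.eq_smul (R := Q) (c := 1) (by rw [one_smul]; exact hQ.1) hQ.2
    rwa [one_smul] at this

/-! ### The shift operators -/

theorem antitone_stair (N : ℕ) : Antitone (stair N) := fun i j h => by
  simp only [stair, Fin.val_rev]
  rw [Fin.le_def] at h
  omega

theorem domLT_add_stair {μ l : Fin N → ℕ} (h : DomLT μ l) : DomLT (μ + stair N) (l + stair N) := by
  refine ⟨fun k => ?_, fun e => h.2 (add_right_cancel e)⟩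
  simp only [Pi.add_apply, Finset.sum_add_distrib]
  exact Nat.add_le_add_right (h.1 k) _

theorem IsHermite.isSym {P : Poly N} (h : IsHermite N β ν P) : IsSym P := by
  have := (isSym_of_mem_lowerSpan h.1).add (isSym_msym ν)
  rwa [sub_add_cancel] at this

theorem IsHermite.mem_lowPoly {P : Poly N} (hν : Antitone ν) (h : IsHermite N β ν P) :
    P ∈ lowPoly ν := by
  have := add_mem (mem_lowPoly_of_mem_lowerSpan h.1).1 (msym_mem_lowPoly hν)
  rwa [sub_add_cancel] at this

theorem IsHermite.coeff_revExpo {P : Poly N} (h : IsHermite N β ν P) :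
    coeff (revExpo ν) P = 1 := by
  have := (mem_lowPoly_of_mem_lowerSpan h.1).2
  rw [coeff_sub, coeff_revExpo_msym] at this
  linear_combination this

theorem sub_smul_msym_mem_lowerSpan (hν : Antitone ν) {f : Poly N} (hs : IsSym f)
    (hf : f ∈ lowPoly ν) : f - coeff (revExpo ν) f • msym ν ∈ lowerSpan ν := by
  refine (hs.sub ((isSym_msym ν).smul _)).mem_lowerSpan
    (sub_mem hf (Submodule.smul_mem _ _ (msym_mem_lowPoly hν))) ?_
  rw [coeff_sub, coeff_smul, coeff_revExpo_msym, smul_eq_mul, mul_one, sub_self]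

/-- The source of the shift in `β`: the two Vandermonde factors raise the exponent in the weight
from `2β` to `2β + 2`. -/
theorem scal_vand_mul (f g : Poly N) :
    scal N β (vand N * f) (vand N * g) = scal N (β + 1) f g := by
  rw [scal_eq, scal_eq]
  congr 1
  ring

/-- The sum of the images of a polynomial under all permutations of the variables. -/
def symmetrize (f : Poly N) : Poly N := ∑ w : Equiv.Perm (Fin N), rename w f

/-- The signed sum of the images of a polynomial under all permutations of the variables. -/
def antisymmetrize (f : Poly N) : Poly N :=
  ∑ w : Equiv.Perm (Fin N), ((Equiv.Perm.sign w : ℤ) : ℂ) • rename w f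

theorem isSym_symmetrize (f : Poly N) : IsSym (symmetrize f) := by
  intro v
  rw [symmetrize, map_sum]
  refine Fintype.sum_equiv (Equiv.mulLeft v) _ _ fun w => ?_
  rw [rename_rename]
  rfl

theorem sign_mul_self (w : Equiv.Perm (Fin N)) :
    ((Equiv.Perm.sign w : ℤ) : ℂ) * ((Equiv.Perm.sign w : ℤ) : ℂ) = 1 := by
  rcases Int.units_eq_one_or (Equiv.Perm.sign w) with h | h <;> simp [h]

theorem isAlt_antisymmetrize (f : Poly N) : IsAlt (antisymmetrize f) := by
  intro v
  rw [antisymmetrize, map_sum, Finset.smul_sum]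
  refine Fintype.sum_equiv (Equiv.mulLeft v) _ _ fun w => ?_
  rw [map_smul, rename_rename, Equiv.coe_mulLeft, smul_smul, map_mul, Units.val_mul, Int.cast_mul,
    ← mul_assoc, sign_mul_self, one_mul]
  rfl

theorem symmetrize_mem_lowPoly {f : Poly N} (hf : f ∈ lowPoly ν) : symmetrize f ∈ lowPoly ν :=
  Submodule.sum_mem _ fun w _ => rename_mem_lowPoly w hf

theorem antisymmetrize_mem_lowPoly {f : Poly N} (hf : f ∈ lowPoly ν) :
    antisymmetrize f ∈ lowPoly ν :=
  Submodule.sum_mem _ fun w _ => Submodule.smul_mem _ _ (rename_mem_lowPoly w hf)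

theorem card_perm_ne_zero (N : ℕ) : (Fintype.card (Equiv.Perm (Fin N)) : ℂ) ≠ 0 :=
  Nat.cast_ne_zero.2 Fintype.card_ne_zero

/-- All permuted copies of `f` pair equally with a symmetric `P`. No normalisation of the average is
needed, since only vanishing is at stake. -/
theorem scal_eq_zero_of_symmetrize {P f : Poly N} (hP : IsSym P)
    (h : scalForm N β P (symmetrize f) = 0) : scalForm N β P f = 0 := by
  have hw : ∀ w : Equiv.Perm (Fin N), scalForm N β P (rename w f) = scalForm N β P f := by
    intro w
    have := scal_rename (β := β) w P f
    rwa [hP w] at this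
  rw [symmetrize, map_sum, Finset.sum_congr rfl fun w _ => hw w, Finset.sum_const, nsmul_eq_mul,
    Finset.card_univ] at h
  exact (mul_eq_zero.1 h).resolve_left (card_perm_ne_zero N)

theorem scal_eq_zero_of_antisymmetrize {P f : Poly N} (hP : IsAlt P)
    (h : scalForm N β P (antisymmetrize f) = 0) : scalForm N β P f = 0 := by
  have hw : ∀ w : Equiv.Perm (Fin N),
      scalForm N β P (((Equiv.Perm.sign w : ℤ) : ℂ) • rename w f) = scalForm N β P f := by
    intro w
    have := scal_rename (β := β) w P f
    rwa [hP w, ← scalForm_apply, map_smul, LinearMap.smul_apply, ← map_smul] at this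
  rw [antisymmetrize, map_sum, Finset.sum_congr rfl fun w _ => hw w, Finset.sum_const,
    nsmul_eq_mul, Finset.card_univ] at h
  exact (mul_eq_zero.1 h).resolve_left (card_perm_ne_zero N)

theorem eval_pairPoly (c : ℂ) (e : Fin N → ℂ) : eval e (pairPoly N c)
    = ∏ i : Fin N, ∏ j ∈ Finset.univ.filter (fun j => i < j), (c + e i - e j) := by
  simp [pairPoly, map_prod]

theorem prod_neg_one_mul_self (N : ℕ) :
    coeff (revExpo (stair N)) (vand N) * coeff (revExpo (stair N)) (vand N) = 1 := by
  rw [coeff_vand, ← Finset.prod_mul_distrib]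
  refine Finset.prod_eq_one fun i _ => ?_
  rw [← Finset.prod_mul_distrib]
  exact Finset.prod_eq_one fun j _ => by norm_num

/-- Each factor of the evaluated product is minus the corresponding factor of the constant, and the
Vandermonde coefficient is the product of these signs. With indices starting at `0`, the reversed
staircase has entry `i` at `i`. -/
theorem coeff_vand_mul_shiftC (N β : ℕ) (l : Fin N → ℕ) :
    coeff (revExpo (stair N)) (vand N) * shiftC N β l
      = eval (fun i => ((l + stair N) (Fin.rev i) : ℂ) + (β : ℂ) * (i : ℕ)) (pairPoly N β) := by
  rw [coeff_vand, shiftC, eval_pairPoly, ← Finset.prod_mul_distrib]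
  refine Finset.prod_congr rfl fun i _ => ?_
  rw [← Finset.prod_mul_distrib]
  refine Finset.prod_congr rfl fun j _ => ?_
  simp only [Pi.add_apply, stair, Fin.rev_rev]
  push_cast
  ring

theorem coeff_vand_mul_shiftCtilde (N β : ℕ) (l : Fin N → ℕ) :
    coeff (revExpo (stair N)) (vand N) * shiftCtilde N β l
      = eval (fun i => ((l + stair N) (Fin.rev i) : ℂ) + (β : ℂ) * (i : ℕ)) (pairPoly N (-β)) := by
  rw [coeff_vand, shiftCtilde, eval_pairPoly, ← Finset.prod_mul_distrib]
  refine Finset.prod_congr rfl fun i _ => ?_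
  rw [← Finset.prod_mul_distrib]
  refine Finset.prod_congr rfl fun j _ => ?_
  simp only [Pi.add_apply, stair, Fin.rev_rev]
  push_cast
  ring

theorem opY_isHermite {l : Fin N → ℕ} (hl : Antitone l) {P Q : Poly N}
    (hP : IsHermite N β (l + stair N) P) (hQ : IsHermite N (β + 1) l Q) :
    opY N β P = vand N * (shiftC N β l • Q) := by
  have hν : Antitone (l + stair N) := hl.add (antitone_stair N)
  obtain ⟨R, hRs, hR⟩ := exists_vand_mul (isAlt_opY (β := β) hP.isSym)
  have hlow : vand N * R ∈ lowPoly (l + stair N) := by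
    rw [← hR, opY_eq]
    exact hHom_mem_lowPoly _ (hP.mem_lowPoly hν)
  have hRl := mem_lowPoly_of_vand_mul hRs hlow
  have hc : coeff (revExpo l) R = shiftC N β l := by
    refine mul_left_cancel₀ (coeff_vand_ne_zero N) ?_
    rw [← coeff_vand_mul hRl, coeff_vand_mul_shiftC, ← hR, opY_eq,
      coeff_revExpo_hHom _ (hP.mem_lowPoly hν), hP.coeff_revExpo, mul_one]
  rw [hR]
  congr 1
  refine hQ.eq_smul (hc ▸ sub_smul_msym_mem_lowerSpan hl hRs hRl) fun μ hμ hd => ?_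
  -- The pairing of `R` with `m_μ` at `β + 1` becomes that of `P` with `𝒴 (𝒳 m_μ)` at `β`.
  -- Symmetrising the latter gives a combination of partitions below `l + δ`.
  rw [← scal_vand_mul, ← hR, ← scalForm_apply, opY_eq, scal_hHom]
  refine scal_eq_zero_of_symmetrize hP.isSym (scal_eq_zero_of_mem_lowerSpan hP.2 ?_)
  exact (isSym_symmetrize _).mem_lowerSpan_of_domLT (domLT_add_stair hd) (symmetrize_mem_lowPoly
    (hHom_mem_lowPoly _ (vand_mul_mem_lowPoly (isSym_msym μ) (msym_mem_lowPoly hμ))))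

theorem shiftGhat_isHermite {l : Fin N → ℕ} (hl : Antitone l) {P Q : Poly N}
    (hP : IsHermite N β (l + stair N) P) (hQ : IsHermite N (β + 1) l Q) :
    shiftGhat N β Q = shiftCtilde N β l • P := by
  have hν : Antitone (l + stair N) := hl.add (antitone_stair N)
  have hQl := hQ.mem_lowPoly hl
  have hXQ := vand_mul_mem_lowPoly hQ.isSym hQl
  have hs : IsSym (shiftGhat N β Q) := isSym_opYhat (isAlt_vand_mul hQ.isSym)
  have hlow : shiftGhat N β Q ∈ lowPoly (l + stair N) := by
    rw [shiftGhat, opYhat_eq]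
    exact hHom_mem_lowPoly _ hXQ
  have hc : coeff (revExpo (l + stair N)) (shiftGhat N β Q) = shiftCtilde N β l := by
    rw [shiftGhat, opYhat_eq, coeff_revExpo_hHom _ hXQ, coeff_vand_mul hQl, hQ.coeff_revExpo,
      ← coeff_vand_mul_shiftCtilde]
    linear_combination shiftCtilde N β l * prod_neg_one_mul_self N
  refine hP.eq_smul (hc ▸ sub_smul_msym_mem_lowerSpan hν hs hlow) fun μ hμ hd => ?_
  rw [← scalForm_apply, shiftGhat, opYhat_eq, scal_hHom]
  -- The adjoint `𝒴̂` has moved onto `m_μ`. Its skew-symmetrisation is `𝒳 T`, and the vanishing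
  -- coefficient at `l + δ` forces that of `T` at `l` to vanish, so `T` is orthogonal to `Q` at `β +
  -- 1`.
  refine scal_eq_zero_of_antisymmetrize (isAlt_vand_mul hQ.isSym) ?_
  set G := hHom N β (pairPoly N (-β)) (msym μ)
  have hA : antisymmetrize G ∈ lowPoly μ :=
    antisymmetrize_mem_lowPoly (hHom_mem_lowPoly _ (msym_mem_lowPoly hμ))
  have hA0 := coeff_revExpo_eq_zero_of_domLT hd hA
  have hA1 := lowPoly_mono hd.1 hA
  obtain ⟨T, hT, hAT⟩ := exists_vand_mul (isAlt_antisymmetrize G)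
  rw [hAT] at hA0 hA1 ⊢
  have hTl := mem_lowPoly_of_vand_mul hT hA1
  rw [coeff_vand_mul hTl] at hA0
  rw [scalForm_apply, scal_vand_mul]
  exact scal_eq_zero_of_mem_lowerSpan hQ.2
    (hT.mem_lowerSpan hTl ((mul_eq_zero.1 hA0).resolve_left (coeff_vand_ne_zero N)))

end HermiteShift

end

theorem mainTheorem7 (N β : ℕ) (l : Fin N → ℕ) (hl : Antitone l) :
    (∃! P, HermiteShift.IsHermite N β (l + HermiteShift.stair N) P) ∧
    (∃! Q, HermiteShift.IsHermite N (β + 1) l Q) ∧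
    ∀ P Q : HermiteShift.Poly N,
      HermiteShift.IsHermite N β (l + HermiteShift.stair N) P →
      HermiteShift.IsHermite N (β + 1) l Q →
      HermiteShift.shiftG N β P =
        algebraMap (HermiteShift.Poly N) (FractionRing (HermiteShift.Poly N))
          (HermiteShift.shiftC N β l • Q) ∧
      HermiteShift.shiftGhat N β Q = HermiteShift.shiftCtilde N β l • P := by
  refine ⟨HermiteShift.existsUnique_isHermite β _, HermiteShift.existsUnique_isHermite _ l,
    fun P Q hP hQ => ⟨?_, HermiteShift.shiftGhat_isHermite hl hP hQ⟩⟩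
  rw [HermiteShift.shiftG, HermiteShift.opY_isHermite hl hP hQ, map_mul, inv_mul_cancel_left₀]
  exact (map_ne_zero_iff _ (IsFractionRing.injective _ _)).2 (HermiteShift.vand_ne_zero N)
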